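/- Let $(M,\eta)$ be a smooth Riemannian manifold of dimension $m$, and let $\Sigma$ be an $n$-dimensional (immersed, in particular embedded) smooth submanifold of $M$ with inclusion map $f:\Sigma\to M$ and induced metric $g=f^*\eta$, with inverse $g^{-1}$ on $1$-forms. Let $\theta$ be an almost Kähler–Poisson structure on $(\Sigma,g)$ with characteristic function $\gamma^2$; that is, $\theta$ is a Poisson bivector on $\Sigma$, $\gamma\in C^\infty(\Sigma)$ is strictly positive, and $$\gamma^2\,g^{-1}(\sigma,\tau)=g\big(\theta(\sigma),\theta(\tau)\big)\qquad\text{for all 1-forms }\sigma,\tau\text{ on }\Sigma ,$$ where in local coordinates $\theta(\sigma)^a=\theta^{ab}\sigma_b$. Let $\{u,v\}=\theta^{ab}(\partial_au)(\partial_bv)$ be the associated Poisson bracket. Let $x^1,\dots,x^m$ be any local coordinates on $M$, regarded also as functions on the part of $\Sigma$ lying in the coordinate domain, let $\eta_{ij}$ and $\bar\Gamma^k_{lr}$ be the components of $\eta$ and the Christoffel symbols of its Levi-Civita connection in these coordinates, and sum over repeated indices. For a smooth function $u$ on $\Sigma$ and for a smooth vector field $V=V^k\partial_k$ of $M$ along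 $\Sigma$ put $$\hat\nabla^i(u)=\mathcal D^i(u)=\frac1{\gamma^2}\{u,x^k\}\{x^i,x^l\}\eta_{kl},\qquad \hat\nabla^iV^k=\mathcal D^i(V^k)+\mathcal D^i(x^l)\,\bar\Gamma^k_{lr}V^r,\qquad \hat\nabla_iV^k=\eta_{ij}\hat\nabla^jV^k ,$$ and let $\hat\nabla_i\hat\nabla^j(u)$ denote $\hat\nabla_iV^j$ for the vector field with components $V^j=\hat\nabla^j(u)$. Let $\nabla$ be the Levi-Civita covariant derivative of $(\Sigma,g)$. Then for every $u\in C^\infty(\Sigma)$ and every smooth vector field $X$ on $\Sigma$, with components $X=X^i\partial_i$ when regarded as a vector field of $M$ along $\Sigma$, at every point of $\Sigma$ in the coordinate domain, $$\nabla u=\hat\nabla^i(u)\,\partial_i,\qquad \operatorname{div}(X)=\hat\nabla_iX^i,\qquad \Delta(u)=\hat\nabla_i\hat\nabla^i(u),\qquad |\nabla^2u|^2=\hat\nabla_i\hat\nabla^j(u)\,\hat\nabla_j\hat\nabla^i(u),$$ where $\nabla u$, $\operatorname{div}(X)$, $\Delta(u)=\operatorname{div}(\nabla u)$ and $\nabla^2u$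 are the gradient of $u$, the divergence of $X$, the Laplacian of $u$ and the Hessian (second covariant derivative) of $u$ on $(\Sigma,g)$. -/

import Mathlib

open scoped Manifold ContDiff

noncomputable section

namespace KahlerPoisson

/-- The smooth model space `ℝ^d`. -/
abbrev Model (d : ℕ) : Type := EuclideanSpace ℝ (Fin d)

section Coordinates

variable {d : ℕ} {N : Type*} [TopologicalSpace N] [ChartedSpace (Model d) N]

/-- The coordinate vector `∂_i` at `q` of the chart `φ`, i.e. `(dφ_q)⁻¹ (e_i)`. -/
def coordVector (φ : OpenPartialHomeomorph N (Model d)) (i : Fin d) (q : N) :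
    TangentSpace (𝓡 d) q :=
  (mfderiv (𝓡 d) (𝓡 d) φ q).inverse (EuclideanSpace.single i (1 : ℝ) : Model d)

/-- The differential of a real function, as a covector at `q`. -/
def differential (u : N → ℝ) (q : N) : TangentSpace (𝓡 d) q →L[ℝ] ℝ :=
  mvfderiv (𝓡 d) u q

/-- The coordinate derivative `∂_i u` in the chart `φ`. -/
def partialDeriv (φ : OpenPartialHomeomorph N (Model d)) (i : Fin d) (u : N → ℝ) (q : N) : ℝ :=
  differential u q (coordVector φ i q)

/-- The component `X^a = dφ^a(X)` of a vector field in the chart `φ`. -/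
def component (φ : OpenPartialHomeomorph N (Model d)) (X : ∀ q : N, TangentSpace (𝓡 d) q)
    (a : Fin d) (q : N) : ℝ :=
  differential (fun r => φ r a) q (X q)

end Coordinates

section Metric

variable {d : ℕ} {N : Type*} [TopologicalSpace N] [ChartedSpace (Model d) N]
variable (G : ∀ q : N, TangentSpace (𝓡 d) q →L[ℝ] TangentSpace (𝓡 d) q →L[ℝ] ℝ)

/-- The components `G_{ij}` of the metric in the chart `φ`. -/
def metricCoeff (φ : OpenPartialHomeomorph N (Model d)) (i j : Fin d) (q : N) : ℝ :=
  G q (coordVector φ i q) (coordVector φ j q)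

/-- The components `G^{ij}` of the inverse metric in the chart `φ`. -/
def metricInvCoeff (φ : OpenPartialHomeomorph N (Model d)) (i j : Fin d) (q : N) : ℝ :=
  (Matrix.of fun k l : Fin d => metricCoeff G φ k l q)⁻¹ i j

/-- The Christoffel symbol `Γ^k_{lm}` of the Levi-Civita connection in the chart `φ`. -/
def christoffel (φ : OpenPartialHomeomorph N (Model d)) (k l m : Fin d) (q : N) : ℝ :=
  (1 / 2 : ℝ) * ∑ r, metricInvCoeff G φ k r q *
    (partialDeriv φ l (metricCoeff G φ r m) q + partialDeriv φ m (metricCoeff G φ r l) q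
      - partialDeriv φ r (metricCoeff G φ l m) q)

/-- The vector metrically dual to a covector: `G (raise σ) v = σ v`. -/
def raise (q : N) : (TangentSpace (𝓡 d) q →L[ℝ] ℝ) →L[ℝ] TangentSpace (𝓡 d) q :=
  (G q).inverse

/-- The inverse metric `G⁻¹(σ, τ)` on covectors. -/
def cometric (q : N) (σ τ : TangentSpace (𝓡 d) q →L[ℝ] ℝ) : ℝ :=
  G q (raise G q σ) (raise G q τ)

/-- The gradient of `u`: the vector field metrically dual to `du`. -/
def metricGradient (u : N → ℝ) (q : N) : TangentSpace (𝓡 d) q :=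
  raise G q (differential u q)

/-- The components `∇_a X^b = ∂_a X^b + Γ^b_{ac} X^c` of the Levi-Civita covariant derivative of a
vector field, in the chart `φ`. -/
def covDeriv (φ : OpenPartialHomeomorph N (Model d)) (X : ∀ q : N, TangentSpace (𝓡 d) q)
    (a b : Fin d) (q : N) : ℝ :=
  partialDeriv φ a (component φ X b) q + ∑ c, christoffel G φ b a c q * component φ X c q

/-- The divergence `∇_a X^a`, computed in the chart `φ`. -/
def metricDivergence (φ : OpenPartialHomeomorph N (Model d)) (X : ∀ q : N, TangentSpace (𝓡 d) q)
    (q : N) : ℝ :=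
  ∑ a, covDeriv G φ X a a q

/-- The Laplace operator `div (grad u)`, computed in the chart `φ`. -/
def metricLaplacian (φ : OpenPartialHomeomorph N (Model d)) (u : N → ℝ) (q : N) : ℝ :=
  metricDivergence G φ (metricGradient G u) q

/-- The components `∇_a ∇_b u = ∂_a ∂_b u - Γ^c_{ab} ∂_c u` of the second covariant derivative
(Hessian) of a function, in the chart `φ`. -/
def hessian (φ : OpenPartialHomeomorph N (Model d)) (u : N → ℝ) (a b : Fin d) (q : N) : ℝ :=
  partialDeriv φ a (partialDeriv φ b u) q - ∑ c, christoffel G φ c a b q * partialDeriv φ c u q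

/-- The squared norm `|∇²u|² = g^{ac} g^{be} (∇_a ∇_b u) (∇_c ∇_e u)`, computed in the chart `φ`. -/
def hessianNormSq (φ : OpenPartialHomeomorph N (Model d)) (u : N → ℝ) (q : N) : ℝ :=
  ∑ a, ∑ b, ∑ c, ∑ e, metricInvCoeff G φ a c q * metricInvCoeff G φ b e q *
    hessian G φ u a b q * hessian G φ u c e q

end Metric

section Poisson

variable (n : ℕ) (S : Type*) [TopologicalSpace S] [ChartedSpace (Model n) S]

/-- A Poisson bivector on `S`, given as the family of maps `σ ↦ θ(σ)`, `θ(σ)^a = θ^{ab} σ_b`, from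
covectors to vectors. It is antisymmetric and smooth, and its bracket
`{u, v} = θ^{ab} (∂_a u) (∂_b v) = du (θ(dv))` satisfies the Jacobi identity. The last two
requirements are imposed on germs, so that they are meaningful on every manifold. -/
structure PoissonBivector where
  anchor : ∀ p : S, (TangentSpace (𝓡 n) p →L[ℝ] ℝ) →L[ℝ] TangentSpace (𝓡 n) p
  antisymm : ∀ (p : S) (σ τ : TangentSpace (𝓡 n) p →L[ℝ] ℝ),
    σ (anchor p τ) = - τ (anchor p σ)
  smooth : ∀ (p : S) (u v : S → ℝ),
    ContMDiffAt (𝓡 n) 𝓘(ℝ, ℝ) ∞ u p → ContMDiffAt (𝓡 n) 𝓘(ℝ, ℝ) ∞ v p →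
    ContMDiffAt (𝓡 n) 𝓘(ℝ, ℝ) ∞ (fun q => differential u q (anchor q (differential v q))) p
  jacobi : ∀ (p : S) (u v w : S → ℝ),
    ContMDiffAt (𝓡 n) 𝓘(ℝ, ℝ) ∞ u p → ContMDiffAt (𝓡 n) 𝓘(ℝ, ℝ) ∞ v p →
    ContMDiffAt (𝓡 n) 𝓘(ℝ, ℝ) ∞ w p →
    let br : (S → ℝ) → (S → ℝ) → S → ℝ :=
      fun h k q => differential h q (anchor q (differential k q))
    br u (br v w) p + br v (br w u) p + br w (br u v) p = 0

variable {n S}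

/-- The Poisson bracket `{u, v}`. -/
def PoissonBivector.bracket (θ : PoissonBivector n S) (u v : S → ℝ) (p : S) : ℝ :=
  differential u p (θ.anchor p (differential v p))

/-- `θ` is an almost Kähler–Poisson structure on `(S, g)` with characteristic function `γ²`:
`γ` is smooth, strictly positive, and `γ² g⁻¹(σ, τ) = g(θ(σ), θ(τ))` for all covectors. -/
structure IsAlmostKahlerPoisson
    (g : ∀ p : S, TangentSpace (𝓡 n) p →L[ℝ] TangentSpace (𝓡 n) p →L[ℝ] ℝ)
    (θ : PoissonBivector n S) (γ : S → ℝ) : Prop where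
  smooth : ContMDiff (𝓡 n) 𝓘(ℝ, ℝ) ∞ γ
  pos : ∀ p, 0 < γ p
  compat : ∀ (p : S) (σ τ : TangentSpace (𝓡 n) p →L[ℝ] ℝ),
    γ p ^ 2 * cometric g p σ τ = g p (θ.anchor p σ) (θ.anchor p τ)

end Poisson

section Submanifold

variable {m n : ℕ} {M : Type*} [TopologicalSpace M] [ChartedSpace (Model m) M]
  {S : Type*} [TopologicalSpace S] [ChartedSpace (Model n) S]

/-- The metric induced on `S` by `f : S → M`: `g(v, w) = η(df v, df w)`. -/
def inducedMetric (η : ∀ q : M, TangentSpace (𝓡 m) q →L[ℝ] TangentSpace (𝓡 m) q →L[ℝ] ℝ)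
    (f : S → M) (p : S) : TangentSpace (𝓡 n) p →L[ℝ] TangentSpace (𝓡 n) p →L[ℝ] ℝ :=
  (ContinuousLinearMap.precomp ℝ (mfderiv (𝓡 n) (𝓡 m) f p)).comp
    ((η (f p)).comp (mfderiv (𝓡 n) (𝓡 m) f p))

/-- The embedding coordinate `x^i`, as a function on `S`. -/
def embCoord (f : S → M) (ψ : OpenPartialHomeomorph M (Model m)) (i : Fin m) (p : S) : ℝ :=
  ψ (f p) i

/-- The component `X^i = X(x^i)` in the ambient chart of a vector field `X` tangent to `S`, i.e. the
`i`-th component of `df(X)`. -/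
def ambientComponent (f : S → M) (ψ : OpenPartialHomeomorph M (Model m))
    (X : ∀ p : S, TangentSpace (𝓡 n) p) (i : Fin m) (p : S) : ℝ :=
  differential (embCoord f ψ i) p (X p)

variable (η : ∀ q : M, TangentSpace (𝓡 m) q →L[ℝ] TangentSpace (𝓡 m) q →L[ℝ] ℝ)
  (f : S → M) (θ : PoissonBivector n S) (γ : S → ℝ) (ψ : OpenPartialHomeomorph M (Model m))

/-- `∇̂^i(u) = 𝓓^i(u) = γ⁻² {u, x^k} {x^i, x^l} η_{kl}` for functions `u` on `S`. -/
def hatGrad (i : Fin m) (u : S → ℝ) (p : S) : ℝ :=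
  (1 / γ p ^ 2) * ∑ k, ∑ l, θ.bracket u (embCoord f ψ k) p *
    θ.bracket (embCoord f ψ i) (embCoord f ψ l) p * metricCoeff η ψ k l (f p)

/-- `∇̂^i V^k = 𝓓^i(V^k) + 𝓓^i(x^l) Γ̄^k_{lr} V^r` for an ambient vector field `V` along `S`, given by
its components `V^k`. -/
def hatNabla (i : Fin m) (V : Fin m → S → ℝ) (k : Fin m) (p : S) : ℝ :=
  hatGrad η f θ γ ψ i (V k) p +
    ∑ l, ∑ r, hatGrad η f θ γ ψ i (embCoord f ψ l) p * christoffel η ψ k l r (f p) * V r p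

/-- `∇̂_i V^k = η_{ij} ∇̂^j V^k`. -/
def hatNablaLower (i : Fin m) (V : Fin m → S → ℝ) (k : Fin m) (p : S) : ℝ :=
  ∑ j, metricCoeff η ψ i j (f p) * hatNabla η f θ γ ψ j V k p

/-- `∇̂_i ∇̂^j(u)`: the derivative `∇̂_i` of the vector field with components `∇̂^j(u)`. -/
def hatHess (u : S → ℝ) (i j : Fin m) (p : S) : ℝ :=
  hatNablaLower η f θ γ ψ i (fun k => hatGrad η f θ γ ψ k u) j p

end Submanifold

end KahlerPoisson

end

open KahlerPoisson

/-! The Poisson structure enters only through one identity. Expand `g(θ(dw), θ(dx^i))` with `g =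
f^*η`: the result is `η_{kl} {x^k, w} {x^l, x^i}`, whose two signs cancel. Compatibility of `θ` with
`g` therefore says that `𝓓^i(w) = g⁻¹(dw, dx^i)` (`hatGrad_eq_differential_raise`). By symmetry of
`g⁻¹` this is also `dx^i(grad w)`, which is the gradient formula (`hatGrad_eq_ambientComponent`).

In a chart of `S`, let `W_a^k` be the ambient covariant derivative of `V` along `∂_a`, and let
`P_i^a = η_{ij} g^{ab} ∂_b x^j`. The identity gives `∇̂_i V^k = P_i^a W_a^k`, that is, `∇̂V = PW`
(`hatNablaLower_eq_sum`). If `V` is the image of a tangent field `X`, the Gauss formula says that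
the tangential part of `W` is the intrinsic derivative: `WP = ∇X`
(`sum_ambientCovDeriv_mul_tangentProjection`).

The rest is cyclicity of the trace. `tr(WP) = tr(PW)` is the divergence formula, and the Laplacian
is its case `X = grad u`. Symmetry of the Hessian gives `|∇²u|² = tr((∇ grad u)²)`
(`hessianNormSq_eq`), and `tr((WP)²) = tr((PW)²)` finishes. -/

namespace KahlerPoisson

open Filter Topology

/-! ### Calculus in a chart: coordinate vectors, partial derivatives, smoothness of components. -/

section Chart

variable {d : ℕ} {N : Type*} [TopologicalSpace N] [ChartedSpace (Model d) N]
  {φ : OpenPartialHomeomorph N (Model d)} {q : N}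

instance (q : N) : FiniteDimensional ℝ (TangentSpace (𝓡 d) q) :=
  inferInstanceAs (FiniteDimensional ℝ (Model d))

instance (q : N) : T2Space (TangentSpace (𝓡 d) q) :=
  inferInstanceAs (T2Space (Model d))

theorem differential_congr {u v : N → ℝ} (h : u =ᶠ[𝓝 q] v) :
    differential (d := d) u q = differential v q := by
  change (mfderiv (𝓡 d) 𝓘(ℝ, ℝ) u q : TangentSpace (𝓡 d) q →L[ℝ] ℝ) = mfderiv (𝓡 d) 𝓘(ℝ, ℝ) v q
  exact (h.mfderiv_eq : mfderiv (𝓡 d) 𝓘(ℝ, ℝ) u q = mfderiv (𝓡 d) 𝓘(ℝ, ℝ) v q)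

theorem partialDeriv_congr {u v : N → ℝ} (h : u =ᶠ[𝓝 q] v) (a : Fin d) :
    partialDeriv φ a u q = partialDeriv φ a v q := by
  simp only [partialDeriv, differential_congr h]

theorem partialDeriv_add {u v : N → ℝ} (hu : MDifferentiableAt (𝓡 d) 𝓘(ℝ, ℝ) u q)
    (hv : MDifferentiableAt (𝓡 d) 𝓘(ℝ, ℝ) v q) (a : Fin d) :
    partialDeriv φ a (fun r => u r + v r) q = partialDeriv φ a u q + partialDeriv φ a v q := by
  simp only [partialDeriv, differential, mvfderiv_fun_add hu hv]
  rfl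

theorem partialDeriv_mul {u v : N → ℝ} (hu : MDifferentiableAt (𝓡 d) 𝓘(ℝ, ℝ) u q)
    (hv : MDifferentiableAt (𝓡 d) 𝓘(ℝ, ℝ) v q) (a : Fin d) :
    partialDeriv φ a (fun r => u r * v r) q =
      partialDeriv φ a u q * v q + u q * partialDeriv φ a v q := by
  simp only [partialDeriv, differential, mvfderiv_fun_mul hu hv]
  change u q * mvfderiv (𝓡 d) v q (coordVector φ a q) +
    v q * mvfderiv (𝓡 d) u q (coordVector φ a q) = _
  ring

theorem mdifferentiableAt_sum {ι : Type*} {s : Finset ι} {u : ι → N → ℝ}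
    (hu : ∀ i ∈ s, MDifferentiableAt (𝓡 d) 𝓘(ℝ, ℝ) (u i) q) :
    MDifferentiableAt (𝓡 d) 𝓘(ℝ, ℝ) (fun r => ∑ i ∈ s, u i r) q := by
  classical
  induction s using Finset.induction_on with
  | empty => simpa using mdifferentiableAt_const
  | insert i s hi ih =>
    simp only [Finset.sum_insert hi]
    exact (hu i (by simp)).add (ih fun j hj => hu j (by simp [hj]))

theorem partialDeriv_sum {ι : Type*} {s : Finset ι} {u : ι → N → ℝ}
    (hu : ∀ i ∈ s, MDifferentiableAt (𝓡 d) 𝓘(ℝ, ℝ) (u i) q) (a : Fin d) :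
    partialDeriv φ a (fun r => ∑ i ∈ s, u i r) q = ∑ i ∈ s, partialDeriv φ a (u i) q := by
  classical
  induction s using Finset.induction_on with
  | empty =>
    simp only [Finset.sum_empty, partialDeriv, differential, mvfderiv_const]
    rfl
  | insert i s hi ih =>
    simp only [Finset.sum_insert hi]
    rw [partialDeriv_add (hu i (by simp))
      (mdifferentiableAt_sum fun j hj => hu j (by simp [hj])), ih fun j hj => hu j (by simp [hj])]

theorem partialDeriv_sum_mul {ι : Type*} {s : Finset ι} {u v : ι → N → ℝ}
    (hu : ∀ i ∈ s, MDifferentiableAt (𝓡 d) 𝓘(ℝ, ℝ) (u i) q)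
    (hv : ∀ i ∈ s, MDifferentiableAt (𝓡 d) 𝓘(ℝ, ℝ) (v i) q) (a : Fin d) :
    partialDeriv φ a (fun r => ∑ i ∈ s, u i r * v i r) q =
      ∑ i ∈ s, (partialDeriv φ a (u i) q * v i q + u i q * partialDeriv φ a (v i) q) := by
  rw [partialDeriv_sum (u := fun i r => u i r * v i r) fun i hi => (hu i hi).mul (hv i hi)]
  exact Finset.sum_congr rfl fun i hi => partialDeriv_mul (hu i hi) (hv i hi) a

variable (hφ : φ ∈ IsManifold.maximalAtlas (𝓡 d) ∞ N)
include hφ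

theorem chart_mdifferentiable : φ.MDifferentiable (𝓡 d) (𝓡 d) :=
  ⟨(contMDiffOn_of_mem_maximalAtlas hφ).mdifferentiableOn (by simp),
    (contMDiffOn_symm_of_mem_maximalAtlas hφ).mdifferentiableOn (by simp)⟩

/-- `coordVector` is built on `inverse`, which is zero on non-invertible maps; this excludes the
default value on the chart domain. -/
theorem chart_mfderiv_isInvertible (hq : q ∈ φ.source) :
    (mfderiv (𝓡 d) (𝓡 d) φ q).IsInvertible :=
  ⟨(chart_mdifferentiable hφ).mfderiv hq, rfl⟩

theorem chart_mfderiv_coordVector (hq : q ∈ φ.source) (a : Fin d) :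
    mfderiv (𝓡 d) (𝓡 d) φ q (coordVector φ a q) =
      (EuclideanSpace.single a (1 : ℝ) : Model d) := by
  obtain ⟨e, he⟩ := chart_mfderiv_isInvertible hφ hq
  rw [coordVector, ← he, ContinuousLinearMap.inverse_equiv]
  exact e.apply_symm_apply _

theorem coordVector_eq_mfderiv_symm (hq : q ∈ φ.source) (a : Fin d) :
    coordVector φ a q = mfderiv (𝓡 d) (𝓡 d) φ.symm (φ q)
      (EuclideanSpace.single a (1 : ℝ) : Model d) := by
  have := congrArg (mfderiv (𝓡 d) (𝓡 d) φ.symm (φ q)) (chart_mfderiv_coordVector hφ hq a)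
  rw [← this]
  exact (DFunLike.congr_fun ((chart_mdifferentiable hφ).symm_comp_deriv hq) _).symm

theorem chartCoord_contMDiffOn (i : Fin d) :
    ContMDiffOn (𝓡 d) 𝓘(ℝ, ℝ) ∞ (fun r => φ r i) φ.source := by
  have h : ContMDiff (𝓡 d) 𝓘(ℝ, ℝ) ∞ (fun x : Model d => x i) :=
    (EuclideanSpace.proj i : Model d →L[ℝ] ℝ).contMDiff
  exact h.comp_contMDiffOn (contMDiffOn_of_mem_maximalAtlas hφ)

theorem chartCoord_contMDiffAt (hq : q ∈ φ.source) (i : Fin d) :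
    ContMDiffAt (𝓡 d) 𝓘(ℝ, ℝ) ∞ (fun r => φ r i) q :=
  (chartCoord_contMDiffOn hφ i).contMDiffAt (φ.open_source.mem_nhds hq)

theorem differential_chartCoord (hq : q ∈ φ.source) (i : Fin d) (v : TangentSpace (𝓡 d) q) :
    differential (fun r => φ r i) q v = (show Model d from mfderiv (𝓡 d) (𝓡 d) φ q v) i := by
  have h1 : MDifferentiableAt (𝓡 d) 𝓘(ℝ, ℝ) (fun x : Model d => x i) (φ q) :=
    (EuclideanSpace.proj i : Model d →L[ℝ] ℝ).contMDiff.mdifferentiableAt (n := ∞) (by simp)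
  have h2 := (chart_mdifferentiable hφ).mdifferentiableAt hq
  have := mvfderiv_comp_apply q h1 h2 v
  change mvfderiv (𝓡 d) ((fun x : Model d => x i) ∘ φ) q v = _
  rw [this]
  have h3 : mfderiv (𝓡 d) 𝓘(ℝ, ℝ) (fun x : Model d => x i) (φ q) =
      (EuclideanSpace.proj i : Model d →L[ℝ] ℝ) := by
    rw [mfderiv_eq_fderiv]
    exact (EuclideanSpace.proj i : Model d →L[ℝ] ℝ).fderiv
  change (mfderiv (𝓡 d) 𝓘(ℝ, ℝ) (fun x : Model d => x i) (φ q)) _ = _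
  rw [h3]
  rfl

theorem differential_chartCoord_coordVector (hq : q ∈ φ.source) (i a : Fin d) :
    differential (fun r => φ r i) q (coordVector φ a q) = if i = a then 1 else 0 := by
  rw [differential_chartCoord hφ hq, chart_mfderiv_coordVector hφ hq]
  change (EuclideanSpace.single a (1 : ℝ) : Model d) i = _
  simp

/-- Every tangent vector is the combination of the coordinate vectors with its components. -/
theorem sum_differential_smul_coordVector (hq : q ∈ φ.source) (v : TangentSpace (𝓡 d) q) :
    ∑ i, differential (fun r => φ r i) q v • coordVector φ i q = v := by
  obtain ⟨e, he⟩ := chart_mfderiv_isInvertible hφ hq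
  apply e.injective
  have key : ∀ w, e w = mfderiv (𝓡 d) (𝓡 d) φ q w := fun w => by rw [← he]; rfl
  rw [map_sum]
  simp only [map_smul, key, chart_mfderiv_coordVector hφ hq, differential_chartCoord hφ hq]
  have : ∀ x : Model d, ∑ i, x i • (EuclideanSpace.single i (1 : ℝ) : Model d) = x := by
    intro x
    ext j
    simp [Pi.single_apply]
  exact this _

theorem covector_eq_sum (hq : q ∈ φ.source) (σ : TangentSpace (𝓡 d) q →L[ℝ] ℝ) :
    σ = ∑ a, σ (coordVector φ a q) • differential (fun r => φ r a) q := by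
  ext v
  conv_lhs => rw [← sum_differential_smul_coordVector hφ hq v]
  simp [mul_comm]

/-- Reduces manifold derivatives to Fréchet derivatives on the model space, where smoothness of
derivatives and symmetry of second derivatives are available. No differentiability is assumed:
otherwise both sides take the default value zero. -/
theorem partialDeriv_eq_fderiv (hq : q ∈ φ.source) (u : N → ℝ) (a : Fin d) :
    partialDeriv φ a u q = fderiv ℝ (u ∘ φ.symm) (φ q) (EuclideanSpace.single a 1) := by
  by_cases hu : MDifferentiableAt (𝓡 d) 𝓘(ℝ, ℝ) u q
  swap
  · have hU : ¬ DifferentiableAt ℝ (u ∘ φ.symm) (φ q) := fun h => hu <| by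
      refine (h.mdifferentiableAt.comp q
        ((chart_mdifferentiable hφ).mdifferentiableAt hq)).congr_of_eventuallyEq ?_
      filter_upwards [φ.open_source.mem_nhds hq] with r hr
      simp [φ.left_inv hr]
    rw [fderiv_zero_of_not_differentiableAt hU]
    change mfderiv (𝓡 d) 𝓘(ℝ, ℝ) u q (coordVector φ a q) = 0
    rw [mfderiv_zero_of_not_mdifferentiableAt hu]
    rfl
  have h2 := (chart_mdifferentiable hφ).symm.mdifferentiableAt (φ.map_source hq)
  have h1 : MDifferentiableAt (𝓡 d) 𝓘(ℝ, ℝ) u (φ.symm (φ q)) := by rwa [φ.left_inv hq]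
  have := mvfderiv_comp_apply (φ q) h1 h2 (EuclideanSpace.single a (1 : ℝ) : Model d)
  rw [partialDeriv, coordVector_eq_mfderiv_symm hφ hq]
  have h3 : mvfderiv (𝓡 d) (u ∘ φ.symm) (φ q) = fderiv ℝ (u ∘ φ.symm) (φ q) := by
    rw [← mfderiv_eq_fderiv]; rfl
  rw [← h3]
  refine Eq.trans ?_ this.symm
  change mvfderiv (𝓡 d) u q _ = _
  -- The base points `φ.symm (φ q)` and `q` agree only propositionally, while the type of the
  -- derivative depends on them. Generalizing the point allows substitution.
  have key : ∀ q' (h : q' = q) (w : Model d), (mvfderiv (𝓡 d) u q : Model d → ℝ) w =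
      (mvfderiv (𝓡 d) u q' : Model d → ℝ) w := by
    rintro _ rfl w; rfl
  exact key _ (φ.left_inv hq) _

theorem comp_chart_symm_contDiffAt (hq : q ∈ φ.source) {u : N → ℝ}
    (hu : ContMDiffAt (𝓡 d) 𝓘(ℝ, ℝ) ∞ u q) : ContDiffAt ℝ ∞ (u ∘ φ.symm) (φ q) := by
  rw [← contMDiffAt_iff_contDiffAt]
  refine ContMDiffAt.comp _ (by rwa [φ.left_inv hq]) ?_
  exact contMDiffAt_symm_of_mem_maximalAtlas hφ (φ.map_source hq)

theorem partialDeriv_eventuallyEq (hq : q ∈ φ.source) (u : N → ℝ) (a : Fin d) :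
    partialDeriv φ a u =ᶠ[𝓝 q]
      fun r => fderiv ℝ (u ∘ φ.symm) (φ r) (EuclideanSpace.single a 1) := by
  filter_upwards [φ.open_source.mem_nhds hq] with r hr
  exact partialDeriv_eq_fderiv hφ hr u a

theorem partialDeriv_contMDiffAt (hq : q ∈ φ.source) {u : N → ℝ}
    (hu : ContMDiffAt (𝓡 d) 𝓘(ℝ, ℝ) ∞ u q) (a : Fin d) :
    ContMDiffAt (𝓡 d) 𝓘(ℝ, ℝ) ∞ (partialDeriv φ a u) q := by
  refine ContMDiffAt.congr_of_eventuallyEq ?_ (partialDeriv_eventuallyEq hφ hq u a)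
  have h1 : ContDiffAt ℝ ∞ (fun x => fderiv ℝ (u ∘ φ.symm) x (EuclideanSpace.single a 1)) (φ q) :=
    ((comp_chart_symm_contDiffAt hφ hq hu).fderiv_right (by simp)).clm_apply contDiffAt_const
  exact h1.contMDiffAt.comp q (contMDiffAt_of_mem_maximalAtlas hφ hq)

theorem partialDeriv_comm (hq : q ∈ φ.source) {u : N → ℝ}
    (hu : ContMDiffAt (𝓡 d) 𝓘(ℝ, ℝ) ∞ u q) (a b : Fin d) :
    partialDeriv φ a (partialDeriv φ b u) q = partialDeriv φ b (partialDeriv φ a u) q := by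
  have hU := comp_chart_symm_contDiffAt hφ hq hu
  have hsymm : IsSymmSndFDerivAt ℝ (u ∘ φ.symm) (φ q) :=
    hU.isSymmSndFDerivAt (by simpa using by norm_cast)
  have key : ∀ a b, partialDeriv φ a (partialDeriv φ b u) q =
      fderiv ℝ (fderiv ℝ (u ∘ φ.symm)) (φ q) (EuclideanSpace.single a 1)
        (EuclideanSpace.single b 1) := by
    intro a b
    rw [partialDeriv_eq_fderiv hφ hq]
    have h1 : partialDeriv φ b u ∘ φ.symm =ᶠ[𝓝 (φ q)]
        fun x => fderiv ℝ (u ∘ φ.symm) x (EuclideanSpace.single b 1) := by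
      have h2 : Tendsto φ.symm (𝓝 (φ q)) (𝓝 q) := by
        have := φ.symm.continuousAt (φ.map_source hq)
        rwa [ContinuousAt, φ.left_inv hq] at this
      filter_upwards [h2.eventually (partialDeriv_eventuallyEq hφ hq u b),
        φ.open_target.mem_nhds (φ.map_source hq)] with x hx hxt
      simp only [Function.comp_apply]
      rw [hx, φ.right_inv hxt]
    rw [h1.fderiv_eq]
    have h3 : DifferentiableAt ℝ (fderiv ℝ (u ∘ φ.symm)) (φ q) :=
      (hU.fderiv_right (m := 1) (by norm_cast)).differentiableAt (by simp)
    rw [fderiv_clm_apply h3 (by fun_prop)]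
    simp
  rw [key, key]
  exact hsymm _ _

theorem component_mdifferentiableAt [IsManifold (𝓡 d) ∞ N] (hq : q ∈ φ.source)
    {X : ∀ q : N, TangentSpace (𝓡 d) q}
    (hX : ContMDiff (𝓡 d) (𝓡 d).tangent ∞ (fun p => (⟨p, X p⟩ : TangentBundle (𝓡 d) N)))
    (a : Fin d) : MDifferentiableAt (𝓡 d) 𝓘(ℝ, ℝ) (component φ X a) q := by
  -- The component is the fibre part of the tangent map of the coordinate function, composed with
  -- the section `X`.
  have h1 := (chartCoord_contMDiffOn hφ a).contMDiffOn_tangentMapWithin (m := 1)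
    (by norm_cast) φ.open_source.uniqueMDiffOn
  have h2 := h1.comp (s := φ.source) (t := Bundle.TotalSpace.proj ⁻¹' φ.source)
    ((hX.of_le (n := ∞) (m := 1) (by simp)).contMDiffOn) (fun r hr => hr)
  have h3 := (contMDiff_snd_tangentBundle_modelSpace ℝ 𝓘(ℝ, ℝ) (n := 1)).comp_contMDiffOn h2
  refine ((h3.contMDiffAt (φ.open_source.mem_nhds hq)).mdifferentiableAt
    (by simp)).congr_of_eventuallyEq ?_
  filter_upwards [φ.open_source.mem_nhds hq] with r hr
  change mfderiv (𝓡 d) 𝓘(ℝ, ℝ) (fun r => φ r a) r (X r) =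
    mfderivWithin (𝓡 d) 𝓘(ℝ, ℝ) (fun r => φ r a) φ.source r (X r)
  rw [mfderivWithin_of_isOpen φ.open_source hr]

theorem metricCoeff_mdifferentiableAt [IsManifold (𝓡 d) ∞ N]
    (η : Bundle.ContMDiffRiemannianMetric (𝓡 d) ∞ (Model d) (fun q : N => TangentSpace (𝓡 d) q))
    (hq : q ∈ φ.source) (i j : Fin d) :
    MDifferentiableAt (𝓡 d) 𝓘(ℝ, ℝ) (metricCoeff η.inner φ i j) q := by
  -- A coordinate field is the pullback by the chart of a constant field on the model space.
  have hc : ∀ i, ContMDiffAt (𝓡 d) (𝓡 d).tangent 1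
      (fun r => (⟨r, coordVector φ i r⟩ : TangentBundle (𝓡 d) N)) q := by
    intro i
    have hV : ContMDiffAt (𝓡 d) (𝓡 d).tangent 1 (fun x => (⟨x, (EuclideanSpace.single i (1 : ℝ) :
        Model d)⟩ : TangentBundle (𝓡 d) (Model d))) (φ q) :=
      contMDiffAt_vectorSpace_iff_contDiffAt.2 contDiffAt_const
    exact hV.mpullback_vectorField_preimage (n := ∞) (contMDiffAt_of_mem_maximalAtlas hφ hq)
      (chart_mfderiv_isInvertible hφ hq) (by norm_cast)
  have hg := η.contMDiff.of_le (n := ∞) (m := 1) (by simp)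
  have := ContMDiffAt.clm_bundle_apply₂ (F₁ := Model d) (F₂ := Model d) (F₃ := ℝ)
    (E₃ := Bundle.Trivial N ℝ) hg.contMDiffAt (hc i) (hc j)
  rw [Bundle.contMDiffAt_totalSpace] at this
  exact this.2.mdifferentiableAt (by simp)

end Chart

/-! ### Metric algebra: raising indices, Christoffel symbols, gradient and Hessian. -/

section MetricAlgebra

variable {d : ℕ} {N : Type*} [TopologicalSpace N] [ChartedSpace (Model d) N]
  {φ : OpenPartialHomeomorph N (Model d)} {q : N}
  {G : ∀ q : N, TangentSpace (𝓡 d) q →L[ℝ] TangentSpace (𝓡 d) q →L[ℝ] ℝ}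

/-- Positive definiteness makes `v ↦ G(v, ·)` injective, and a finite-dimensional space and its dual
have equal dimension. Hence the `inverse` in `raise` is a genuine one. -/
theorem metric_isInvertible (hpos : ∀ v, v ≠ 0 → 0 < G q v v) : (G q).IsInvertible := by
  have hinj : Function.Injective (G q) := by
    rw [injective_iff_map_eq_zero]
    intro v hv
    by_contra h
    have := hpos v h
    rw [hv] at this
    simp at this
  let L : TangentSpace (𝓡 d) q →ₗ[ℝ] Module.Dual ℝ (TangentSpace (𝓡 d) q) :=
    (LinearMap.toContinuousLinearMap (𝕜 := ℝ) (E := TangentSpace (𝓡 d) q) (F' :=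
      ℝ)).symm.toLinearMap
      ∘ₗ (G q).toLinearMap
  have hL : Function.Injective L := fun v w h => hinj <| (LinearEquiv.injective
    (LinearMap.toContinuousLinearMap (𝕜 := ℝ) (E := TangentSpace (𝓡 d) q) (F' := ℝ)).symm) h
  let e := (LinearEquiv.ofInjectiveOfFinrankEq L hL Subspace.dual_finrank_eq.symm).trans
    (LinearMap.toContinuousLinearMap (𝕜 := ℝ) (E := TangentSpace (𝓡 d) q) (F' := ℝ))
  refine ⟨e.toContinuousLinearEquiv, ?_⟩
  ext v w
  rfl

theorem metric_raise (hpos : ∀ v, v ≠ 0 → 0 < G q v v) (σ : TangentSpace (𝓡 d) q →L[ℝ] ℝ) :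
    G q (raise G q σ) = σ := by
  obtain ⟨e, he⟩ := metric_isInvertible hpos
  rw [raise, ← he, ContinuousLinearMap.inverse_equiv]
  exact e.apply_symm_apply σ

theorem raise_metric (hpos : ∀ v, v ≠ 0 → 0 < G q v v) (v : TangentSpace (𝓡 d) q) :
    raise G q (G q v) = v := by
  obtain ⟨e, he⟩ := metric_isInvertible hpos
  rw [raise, ← he, ContinuousLinearMap.inverse_equiv]
  exact e.symm_apply_apply v

theorem cometric_eq (hpos : ∀ v, v ≠ 0 → 0 < G q v v)
    (σ τ : TangentSpace (𝓡 d) q →L[ℝ] ℝ) : cometric G q σ τ = σ (raise G q τ) := by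
  rw [cometric, metric_raise hpos]

theorem apply_raise_comm (hsymm : ∀ v w, G q v w = G q w v) (hpos : ∀ v, v ≠ 0 → 0 < G q v v)
    (σ τ : TangentSpace (𝓡 d) q →L[ℝ] ℝ) : σ (raise G q τ) = τ (raise G q σ) := by
  rw [← cometric_eq hpos, ← cometric_eq hpos, cometric, hsymm]
  rfl

theorem metric_eq_sum (hφ : φ ∈ IsManifold.maximalAtlas (𝓡 d) ∞ N) (hq : q ∈ φ.source)
    (v w : TangentSpace (𝓡 d) q) :
    G q v w = ∑ i, ∑ j, differential (fun r => φ r i) q v * differential (fun r => φ r j) q w *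
      metricCoeff G φ i j q := by
  conv_lhs => rw [← sum_differential_smul_coordVector hφ hq v,
    ← sum_differential_smul_coordVector hφ hq w]
  simp only [map_sum, map_smul, sum_apply, smul_apply,
    smul_eq_mul, metricCoeff, Finset.mul_sum, mul_assoc]
  rw [Finset.sum_comm]
  exact Finset.sum_congr rfl fun i _ => Finset.sum_congr rfl fun j _ => by ring

/-- Raising the covector `G(∂_c, ·) = ∑_b G_{cb} dx^b` returns `∂_c`, and `dx^a(∂_c) = δ^a_c`. This
identifies the matrix inverse `metricInvCoeff` with the cometric on coordinate differentials. -/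
theorem metricInvCoeff_matrix (hφ : φ ∈ IsManifold.maximalAtlas (𝓡 d) ∞ N) (hq : q ∈ φ.source)
    (hsymm : ∀ v w, G q v w = G q w v) (hpos : ∀ v, v ≠ 0 → 0 < G q v v) :
    (Matrix.of fun a b : Fin d => differential (fun r => φ r a) q
      (raise G q (differential (fun r => φ r b) q))) *
      (Matrix.of fun k l : Fin d => metricCoeff G φ k l q) = 1 := by
  ext a c
  simp only [Matrix.mul_apply, Matrix.of_apply, Matrix.one_apply]
  rw [← differential_chartCoord_coordVector hφ hq a c]
  conv_rhs => rw [← raise_metric hpos (coordVector φ c q), covector_eq_sum hφ hq (G q _)]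
  simp only [map_sum, map_smul, smul_eq_mul, metricCoeff]
  exact Finset.sum_congr rfl fun b _ => by rw [hsymm, mul_comm]

theorem metricInvCoeff_eq (hφ : φ ∈ IsManifold.maximalAtlas (𝓡 d) ∞ N) (hq : q ∈ φ.source)
    (hsymm : ∀ v w, G q v w = G q w v) (hpos : ∀ v, v ≠ 0 → 0 < G q v v) (a b : Fin d) :
    metricInvCoeff G φ a b q = differential (fun r => φ r a) q
      (raise G q (differential (fun r => φ r b) q)) := by
  rw [metricInvCoeff, Matrix.inv_eq_left_inv (metricInvCoeff_matrix hφ hq hsymm hpos)]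
  rfl

theorem metricInvCoeff_symm (hφ : φ ∈ IsManifold.maximalAtlas (𝓡 d) ∞ N) (hq : q ∈ φ.source)
    (hsymm : ∀ v w, G q v w = G q w v) (hpos : ∀ v, v ≠ 0 → 0 < G q v v) (a b : Fin d) :
    metricInvCoeff G φ a b q = metricInvCoeff G φ b a q := by
  rw [metricInvCoeff_eq hφ hq hsymm hpos, metricInvCoeff_eq hφ hq hsymm hpos,
    apply_raise_comm hsymm hpos]

theorem sum_metricInvCoeff_mul (hφ : φ ∈ IsManifold.maximalAtlas (𝓡 d) ∞ N) (hq : q ∈ φ.source)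
    (hsymm : ∀ v w, G q v w = G q w v) (hpos : ∀ v, v ≠ 0 → 0 < G q v v) (a c : Fin d) :
    ∑ b, metricInvCoeff G φ a b q * metricCoeff G φ b c q = if a = c then 1 else 0 := by
  have := congrFun (congrFun (metricInvCoeff_matrix hφ hq hsymm hpos) a) c
  simpa only [metricInvCoeff_eq hφ hq hsymm hpos, Matrix.mul_apply, Matrix.of_apply,
    Matrix.one_apply] using this

theorem sum_mul_metricInvCoeff (hφ : φ ∈ IsManifold.maximalAtlas (𝓡 d) ∞ N) (hq : q ∈ φ.source)
    (hsymm : ∀ v w, G q v w = G q w v) (hpos : ∀ v, v ≠ 0 → 0 < G q v v) (a c : Fin d) :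
    ∑ b, metricCoeff G φ a b q * metricInvCoeff G φ b c q = if a = c then 1 else 0 := by
  have h := mul_eq_one_comm.1 (metricInvCoeff_matrix hφ hq hsymm hpos)
  have := congrFun (congrFun h a) c
  simpa only [metricInvCoeff_eq hφ hq hsymm hpos, Matrix.mul_apply, Matrix.of_apply,
    Matrix.one_apply] using this

theorem apply_raise_eq_sum (hφ : φ ∈ IsManifold.maximalAtlas (𝓡 d) ∞ N) (hq : q ∈ φ.source)
    (hsymm : ∀ v w, G q v w = G q w v) (hpos : ∀ v, v ≠ 0 → 0 < G q v v)
    (σ τ : TangentSpace (𝓡 d) q →L[ℝ] ℝ) :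
    σ (raise G q τ) = ∑ a, ∑ b, metricInvCoeff G φ a b q * σ (coordVector φ a q) *
      τ (coordVector φ b q) := by
  simp only [metricInvCoeff_eq hφ hq hsymm hpos]
  conv_lhs => rw [covector_eq_sum hφ hq σ, covector_eq_sum hφ hq τ]
  simp only [sum_apply, smul_apply, map_sum, map_smul,
    smul_eq_mul, Finset.mul_sum]
  rw [Finset.sum_comm]
  exact Finset.sum_congr rfl fun a _ => Finset.sum_congr rfl fun b _ => by ring

/-- The Christoffel symbols of the first kind. -/
theorem sum_metricCoeff_mul_christoffel (hφ : φ ∈ IsManifold.maximalAtlas (𝓡 d) ∞ N)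
    (hq : q ∈ φ.source) (hsymm : ∀ v w, G q v w = G q w v) (hpos : ∀ v, v ≠ 0 → 0 < G q v v)
    (j l m : Fin d) :
    ∑ k, metricCoeff G φ j k q * christoffel G φ k l m q =
      (1 / 2 : ℝ) * (partialDeriv φ l (metricCoeff G φ j m) q +
        partialDeriv φ m (metricCoeff G φ j l) q - partialDeriv φ j (metricCoeff G φ l m) q) := by
  simp only [christoffel]
  calc _ = (1 / 2 : ℝ) * ∑ r, (∑ k, metricCoeff G φ j k q * metricInvCoeff G φ k r q) *
        (partialDeriv φ l (metricCoeff G φ r m) q + partialDeriv φ m (metricCoeff G φ r l) q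
          - partialDeriv φ r (metricCoeff G φ l m) q) := by
        simp only [Finset.mul_sum, Finset.sum_mul]
        rw [Finset.sum_comm]
        exact Finset.sum_congr rfl fun a _ => Finset.sum_congr rfl fun b _ => by ring
    _ = _ := by
        simp [sum_mul_metricInvCoeff hφ hq hsymm hpos]

theorem christoffel_comm (hsymm : ∀ q v w, G q v w = G q w v) (k l m : Fin d) :
    christoffel G φ k l m q = christoffel G φ k m l q := by
  have : ∀ a b, metricCoeff G φ a b = metricCoeff G φ b a := fun a b => by
    ext r; exact hsymm r _ _
  simp only [christoffel, this l m]
  congr 1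
  exact Finset.sum_congr rfl fun r _ => by ring

theorem component_metricGradient (hφ : φ ∈ IsManifold.maximalAtlas (𝓡 d) ∞ N) (hq : q ∈ φ.source)
    (hsymm : ∀ v w, G q v w = G q w v) (hpos : ∀ v, v ≠ 0 → 0 < G q v v)
    (u : N → ℝ) (c : Fin d) :
    component φ (metricGradient G u) c q =
      ∑ b, metricInvCoeff G φ c b q * partialDeriv φ b u q := by
  rw [component, metricGradient, apply_raise_eq_sum hφ hq hsymm hpos]
  simp [differential_chartCoord_coordVector hφ hq, partialDeriv]

theorem partialDeriv_eq_sum_metricGradient (hφ : φ ∈ IsManifold.maximalAtlas (𝓡 d) ∞ N)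
    (hq : q ∈ φ.source) (hsymm : ∀ v w, G q v w = G q w v) (hpos : ∀ v, v ≠ 0 → 0 < G q v v)
    (u : N → ℝ) (b : Fin d) :
    partialDeriv φ b u q =
      ∑ c, metricCoeff G φ b c q * component φ (metricGradient G u) c q := by
  simp only [component_metricGradient hφ hq hsymm hpos, Finset.mul_sum]
  rw [Finset.sum_comm]
  simp only [← mul_assoc, ← Finset.sum_mul, sum_mul_metricInvCoeff hφ hq hsymm hpos]
  simp

theorem mdifferentiableAt_prod {ι : Type*} {s : Finset ι} {u : ι → N → ℝ}
    (hu : ∀ i ∈ s, MDifferentiableAt (𝓡 d) 𝓘(ℝ, ℝ) (u i) q) :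
    MDifferentiableAt (𝓡 d) 𝓘(ℝ, ℝ) (fun r => ∏ i ∈ s, u i r) q := by
  classical
  induction s using Finset.induction_on with
  | empty => simpa using mdifferentiableAt_const
  | insert i s hi ih =>
    simp only [Finset.prod_insert hi]
    exact (hu i (by simp)).mul (ih fun j hj => hu j (by simp [hj]))

theorem det_mdifferentiableAt {A : N → Matrix (Fin d) (Fin d) ℝ}
    (hA : ∀ i j, MDifferentiableAt (𝓡 d) 𝓘(ℝ, ℝ) (fun r => A r i j) q) :
    MDifferentiableAt (𝓡 d) 𝓘(ℝ, ℝ) (fun r => (A r).det) q := by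
  simp only [Matrix.det_apply']
  exact mdifferentiableAt_sum fun σ _ =>
    mdifferentiableAt_const.mul (mdifferentiableAt_prod fun i _ => hA _ _)

/-- Cramer's rule: the entries of the inverse are polynomials in the entries of `A` divided by `det
A`. -/
theorem matrix_inv_mdifferentiableAt {A : N → Matrix (Fin d) (Fin d) ℝ}
    (hA : ∀ i j, MDifferentiableAt (𝓡 d) 𝓘(ℝ, ℝ) (fun r => A r i j) q) (h0 : (A q).det ≠ 0)
    (i j : Fin d) : MDifferentiableAt (𝓡 d) 𝓘(ℝ, ℝ) (fun r => (A r)⁻¹ i j) q := by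
  simp only [Matrix.inv_def, Matrix.smul_apply, smul_eq_mul, Ring.inverse_eq_inv',
    Matrix.adjugate_apply]
  refine MDifferentiableAt.mul ?_ (det_mdifferentiableAt fun k l => ?_)
  · exact MDifferentiableAt.comp q (differentiableAt_inv h0).mdifferentiableAt
      (det_mdifferentiableAt hA)
  · simp only [Matrix.updateRow_apply]
    split_ifs
    · exact mdifferentiableAt_const
    · exact hA k l

theorem metricInvCoeff_mdifferentiableAt (hφ : φ ∈ IsManifold.maximalAtlas (𝓡 d) ∞ N)
    (hq : q ∈ φ.source) (hsymm : ∀ v w, G q v w = G q w v) (hpos : ∀ v, v ≠ 0 → 0 < G q v v)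
    (hG : ∀ a b, MDifferentiableAt (𝓡 d) 𝓘(ℝ, ℝ) (metricCoeff G φ a b) q) (a b : Fin d) :
    MDifferentiableAt (𝓡 d) 𝓘(ℝ, ℝ) (metricInvCoeff G φ a b) q := by
  refine matrix_inv_mdifferentiableAt (A := fun r => Matrix.of fun k l => metricCoeff G φ k l r)
    hG ?_ a b
  intro h
  have := congrArg Matrix.det (metricInvCoeff_matrix hφ hq hsymm hpos)
  simp [Matrix.det_mul, h] at this

theorem component_metricGradient_mdifferentiableAt (hφ : φ ∈ IsManifold.maximalAtlas (𝓡 d) ∞ N)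
    (hq : q ∈ φ.source) (hsymm : ∀ q v w, G q v w = G q w v)
    (hpos : ∀ q v, v ≠ 0 → 0 < G q v v)
    (hG : ∀ a b, MDifferentiableAt (𝓡 d) 𝓘(ℝ, ℝ) (metricCoeff G φ a b) q)
    {u : N → ℝ} (hu : ContMDiffAt (𝓡 d) 𝓘(ℝ, ℝ) ∞ u q) (c : Fin d) :
    MDifferentiableAt (𝓡 d) 𝓘(ℝ, ℝ) (component φ (metricGradient G u) c) q := by
  have h : MDifferentiableAt (𝓡 d) 𝓘(ℝ, ℝ)
      (fun r => ∑ b, metricInvCoeff G φ c b r * partialDeriv φ b u r) q :=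
    mdifferentiableAt_sum fun b _ =>
      (metricInvCoeff_mdifferentiableAt hφ hq (hsymm q) (hpos q) hG c b).mul
        ((partialDeriv_contMDiffAt hφ hq hu b).mdifferentiableAt (by simp))
  refine h.congr_of_eventuallyEq ?_
  filter_upwards [φ.open_source.mem_nhds hq] with r hr
  exact component_metricGradient hφ hr (hsymm r) (hpos r) u c

/-- The Hessian is the covariant derivative of the gradient with the index lowered. -/
theorem hessian_eq_sum_covDeriv (hφ : φ ∈ IsManifold.maximalAtlas (𝓡 d) ∞ N)
    (hq : q ∈ φ.source) (hsymm : ∀ q v w, G q v w = G q w v)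
    (hpos : ∀ q v, v ≠ 0 → 0 < G q v v)
    (hG : ∀ a b, MDifferentiableAt (𝓡 d) 𝓘(ℝ, ℝ) (metricCoeff G φ a b) q)
    {u : N → ℝ} (hu : ContMDiffAt (𝓡 d) 𝓘(ℝ, ℝ) ∞ u q) (a b : Fin d) :
    hessian G φ u a b q =
      ∑ c, metricCoeff G φ b c q * covDeriv G φ (metricGradient G u) a c q := by
  have hY := component_metricGradient_mdifferentiableAt hφ hq hsymm hpos hG hu
  have hcomm : ∀ a b, metricCoeff G φ a b = metricCoeff G φ b a := fun a b => by
    ext r; exact hsymm r _ _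
  have h1 : partialDeriv φ b u =ᶠ[𝓝 q]
      fun r => ∑ c, metricCoeff G φ b c r * component φ (metricGradient G u) c r := by
    filter_upwards [φ.open_source.mem_nhds hq] with r hr
    exact partialDeriv_eq_sum_metricGradient hφ hr (hsymm r) (hpos r) u b
  have h2 : ∑ c, christoffel G φ c a b q * partialDeriv φ c u q =
      ∑ e, (∑ c, metricCoeff G φ e c q * christoffel G φ c a b q) *
        component φ (metricGradient G u) e q := by
    simp only [partialDeriv_eq_sum_metricGradient hφ hq (hsymm q) (hpos q) u, Finset.mul_sum,
      Finset.sum_mul]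
    rw [Finset.sum_comm]
    exact Finset.sum_congr rfl fun e _ => Finset.sum_congr rfl fun c _ => by
      rw [hcomm c e]; ring
  have h3 : ∑ c, metricCoeff G φ b c q * covDeriv G φ (metricGradient G u) a c q =
      ∑ c, metricCoeff G φ b c q * partialDeriv φ a (component φ (metricGradient G u) c) q +
      ∑ e, (∑ c, metricCoeff G φ b c q * christoffel G φ c a e q) *
        component φ (metricGradient G u) e q := by
    simp only [covDeriv, mul_add, Finset.sum_add_distrib, Finset.mul_sum, Finset.sum_mul]
    congr 1
    rw [Finset.sum_comm]
    exact Finset.sum_congr rfl fun e _ => Finset.sum_congr rfl fun c _ => by ring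
  rw [hessian, partialDeriv_congr h1,
    partialDeriv_sum_mul (fun c _ => hG b c) (fun c _ => hY c), h2, h3]
  -- Both contractions become first-kind symbols, and `Γ_{b,ae} + Γ_{e,ab} = ∂_a G_{be}` (metric
  -- compatibility) then closes the identity term by term.
  simp only [sum_metricCoeff_mul_christoffel hφ hq (hsymm q) (hpos q)]
  rw [← Finset.sum_sub_distrib, ← Finset.sum_add_distrib]
  refine Finset.sum_congr rfl fun e _ => ?_
  rw [hcomm e b, hcomm b a, hcomm a e]
  ring

/-- Mixed partial derivatives commute and the connection is torsion-free. -/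
theorem hessian_comm (hφ : φ ∈ IsManifold.maximalAtlas (𝓡 d) ∞ N)
    (hq : q ∈ φ.source) (hsymm : ∀ q v w, G q v w = G q w v)
    {u : N → ℝ} (hu : ContMDiffAt (𝓡 d) 𝓘(ℝ, ℝ) ∞ u q) (a b : Fin d) :
    hessian G φ u a b q = hessian G φ u b a q := by
  rw [hessian, hessian, partialDeriv_comm hφ hq hu]
  congr 1
  exact Finset.sum_congr rfl fun c _ => by rw [christoffel_comm hsymm]

theorem covDeriv_eq_sum_hessian (hφ : φ ∈ IsManifold.maximalAtlas (𝓡 d) ∞ N)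
    (hq : q ∈ φ.source) (hsymm : ∀ q v w, G q v w = G q w v)
    (hpos : ∀ q v, v ≠ 0 → 0 < G q v v)
    (hG : ∀ a b, MDifferentiableAt (𝓡 d) 𝓘(ℝ, ℝ) (metricCoeff G φ a b) q)
    {u : N → ℝ} (hu : ContMDiffAt (𝓡 d) 𝓘(ℝ, ℝ) ∞ u q) (a b : Fin d) :
    covDeriv G φ (metricGradient G u) a b q =
      ∑ c, metricInvCoeff G φ b c q * hessian G φ u a c q := by
  simp only [hessian_eq_sum_covDeriv hφ hq hsymm hpos hG hu, Finset.mul_sum]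
  rw [Finset.sum_comm]
  simp only [← mul_assoc, ← Finset.sum_mul, sum_metricInvCoeff_mul hφ hq (hsymm q) (hpos q)]
  simp

/-- `|∇²u|² = (∇_a Y^b) (∇_b Y^a)` for the gradient `Y` of `u`. -/
theorem hessianNormSq_eq (hφ : φ ∈ IsManifold.maximalAtlas (𝓡 d) ∞ N)
    (hq : q ∈ φ.source) (hsymm : ∀ q v w, G q v w = G q w v)
    (hpos : ∀ q v, v ≠ 0 → 0 < G q v v)
    (hG : ∀ a b, MDifferentiableAt (𝓡 d) 𝓘(ℝ, ℝ) (metricCoeff G φ a b) q)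
    {u : N → ℝ} (hu : ContMDiffAt (𝓡 d) 𝓘(ℝ, ℝ) ∞ u q) :
    hessianNormSq G φ u q = ∑ a, ∑ b, covDeriv G φ (metricGradient G u) a b q *
      covDeriv G φ (metricGradient G u) b a q := by
  simp only [covDeriv_eq_sum_hessian hφ hq hsymm hpos hG hu, Finset.sum_mul_sum, hessianNormSq]
  refine Finset.sum_congr rfl fun a _ => ?_
  calc _ = ∑ b, ∑ e, ∑ c, metricInvCoeff G φ a c q * metricInvCoeff G φ b e q *
        hessian G φ u a b q * hessian G φ u c e q :=
        Finset.sum_congr rfl fun b _ => Finset.sum_comm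
    _ = _ := by
        rw [Finset.sum_comm]
        refine Finset.sum_congr rfl fun e _ => Finset.sum_congr rfl fun b _ =>
          Finset.sum_congr rfl fun c _ => ?_
        -- Swapping the indices of one Hessian turns the full contraction into the trace of a
        -- square.
        rw [hessian_comm hφ hq hsymm hu c e, metricInvCoeff_symm hφ hq (hsymm q) (hpos q) b e]
        ring

end MetricAlgebra

/-! ### The induced metric and the role of the Poisson structure. -/

section Induced

variable {m n : ℕ} {M : Type*} [TopologicalSpace M] [ChartedSpace (Model m) M]
  {S : Type*} [TopologicalSpace S] [ChartedSpace (Model n) S]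
  {f : S → M} {p : S}
  {ψ : OpenPartialHomeomorph M (Model m)} {φ : OpenPartialHomeomorph S (Model n)}

section General

variable {η : ∀ q : M, TangentSpace (𝓡 m) q →L[ℝ] TangentSpace (𝓡 m) q →L[ℝ] ℝ}

theorem inducedMetric_apply (v w : TangentSpace (𝓡 n) p) :
    inducedMetric η f p v w =
      η (f p) (mfderiv (𝓡 n) (𝓡 m) f p v) (mfderiv (𝓡 n) (𝓡 m) f p w) :=
  rfl

theorem inducedMetric_symm (hη : ∀ q v w, η q v w = η q w v) (p : S)
    (v w : TangentSpace (𝓡 n) p) : inducedMetric η f p v w = inducedMetric η f p w v :=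
  hη _ _ _

theorem inducedMetric_pos (hη : ∀ q v, v ≠ 0 → 0 < η q v v)
    (hf_inj : ∀ p : S, Function.Injective (mfderiv (𝓡 n) (𝓡 m) f p)) (p : S)
    (v : TangentSpace (𝓡 n) p) (hv : v ≠ 0) : 0 < inducedMetric η f p v v :=
  hη _ _ fun h => hv (hf_inj p (h.trans (map_zero _).symm))

theorem emb_preimage_mem_nhds (hf : ContMDiff (𝓡 n) (𝓡 m) ∞ f) (hpψ : f p ∈ ψ.source) :
    f ⁻¹' ψ.source ∈ 𝓝 p :=
  hf.continuous.continuousAt.preimage_mem_nhds (ψ.open_source.mem_nhds hpψ)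

omit [ChartedSpace (Model m) M] in
theorem ambientComponent_eq_sum (hφ : φ ∈ IsManifold.maximalAtlas (𝓡 n) ∞ S)
    (hpφ : p ∈ φ.source) (X : ∀ p : S, TangentSpace (𝓡 n) p) (i : Fin m) :
    ambientComponent f ψ X i p =
      ∑ c, component φ X c p * partialDeriv φ c (embCoord f ψ i) p := by
  rw [ambientComponent]
  conv_lhs => rw [← sum_differential_smul_coordVector hφ hpφ (X p)]
  simp only [map_sum, map_smul, smul_eq_mul]
  rfl

variable (hf : ContMDiff (𝓡 n) (𝓡 m) ∞ f) (hψ : ψ ∈ IsManifold.maximalAtlas (𝓡 m) ∞ M)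
  (hpψ : f p ∈ ψ.source)
include hf hψ hpψ

theorem embCoord_contMDiffAt (i : Fin m) :
    ContMDiffAt (𝓡 n) 𝓘(ℝ, ℝ) ∞ (embCoord f ψ i) p :=
  (chartCoord_contMDiffAt hψ hpψ i).comp p hf.contMDiffAt

theorem differential_embCoord (i : Fin m) (v : TangentSpace (𝓡 n) p) :
    differential (embCoord f ψ i) p v =
      differential (fun r => ψ r i) (f p) (mfderiv (𝓡 n) (𝓡 m) f p v) :=
  mvfderiv_comp_apply p ((chartCoord_contMDiffAt hψ hpψ i).mdifferentiableAt (by simp))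
    (hf.mdifferentiableAt (by simp)) v

theorem inducedMetric_eq_sum (v w : TangentSpace (𝓡 n) p) :
    inducedMetric η f p v w = ∑ i, ∑ j, differential (embCoord f ψ i) p v *
      differential (embCoord f ψ j) p w * metricCoeff η ψ i j (f p) := by
  rw [inducedMetric_apply, metric_eq_sum hψ hpψ]
  simp only [differential_embCoord hf hψ hpψ]

theorem partialDeriv_comp_emb {h : M → ℝ} (hh : MDifferentiableAt (𝓡 m) 𝓘(ℝ, ℝ) h (f p))
    (a : Fin n) : partialDeriv φ a (fun r => h (f r)) p =
      ∑ l, partialDeriv φ a (embCoord f ψ l) p * partialDeriv ψ l h (f p) := by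
  have h1 : partialDeriv φ a (fun r => h (f r)) p =
      differential h (f p) (mfderiv (𝓡 n) (𝓡 m) f p (coordVector φ a p)) :=
    mvfderiv_comp_apply p hh (hf.mdifferentiableAt (by simp)) _
  rw [h1, ← sum_differential_smul_coordVector hψ hpψ (mfderiv (𝓡 n) (𝓡 m) f p _)]
  simp only [map_sum, map_smul, smul_eq_mul, ← differential_embCoord hf hψ hpψ]
  rfl

theorem metricCoeff_inducedMetric_eventuallyEq (a b : Fin n) :
    metricCoeff (inducedMetric η f) φ a b =ᶠ[𝓝 p] fun r => ∑ i, ∑ j,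
      partialDeriv φ a (embCoord f ψ i) r * partialDeriv φ b (embCoord f ψ j) r *
        metricCoeff η ψ i j (f r) := by
  filter_upwards [emb_preimage_mem_nhds hf hpψ] with r hr
  exact inducedMetric_eq_sum hf hψ hr _ _

/-- The derivative `∇̂^i w` is the derivative of `w` along the gradient of `x^i`. -/
theorem hatGrad_eq_differential_raise {θ : PoissonBivector n S} {γ : S → ℝ}
    (hθ : IsAlmostKahlerPoisson (inducedMetric η f) θ γ)
    (hpos : ∀ v : TangentSpace (𝓡 n) p, v ≠ 0 → 0 < inducedMetric η f p v v)
    (i : Fin m) (w : S → ℝ) :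
    hatGrad η f θ γ ψ i w p =
      differential w p
        (raise (d := n) (inducedMetric η f) p (differential (embCoord f ψ i) p)) := by
  rw [← cometric_eq hpos]
  have hγ : γ p ^ 2 ≠ 0 := pow_ne_zero _ (hθ.pos p).ne'
  have h := hθ.compat p (differential w p) (differential (embCoord f ψ i) p)
  rw [inducedMetric_eq_sum hf hψ hpψ] at h
  rw [hatGrad, one_div, inv_mul_eq_iff_eq_mul₀ hγ, h]
  refine Finset.sum_congr rfl fun k _ => Finset.sum_congr rfl fun l _ => ?_
  -- Compatibility yields the brackets in the order `{x^k, w} {x^l, x^i}`; antisymmetry flips both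
  -- and the signs cancel.
  rw [PoissonBivector.bracket, PoissonBivector.bracket, θ.antisymm p (differential w p),
    θ.antisymm p (differential (embCoord f ψ i) p), neg_mul_neg]

end General

end Induced

/-! ### The Gauss formula for coordinate fields. -/

section Gauss

variable {m n : ℕ} {M : Type*} [TopologicalSpace M] [ChartedSpace (Model m) M]
  [IsManifold (𝓡 m) ∞ M]
  {S : Type*} [TopologicalSpace S] [ChartedSpace (Model n) S]
  {f : S → M} {p : S}
  {ψ : OpenPartialHomeomorph M (Model m)} {φ : OpenPartialHomeomorph S (Model n)}
  {η : Bundle.ContMDiffRiemannianMetric (𝓡 m) ∞ (Model m) (fun q : M => TangentSpace (𝓡 m) q)}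
  (hf : ContMDiff (𝓡 n) (𝓡 m) ∞ f) (hψ : ψ ∈ IsManifold.maximalAtlas (𝓡 m) ∞ M)
  (hpψ : f p ∈ ψ.source)
  (hφ : φ ∈ IsManifold.maximalAtlas (𝓡 n) ∞ S) (hpφ : p ∈ φ.source)
include hf hψ hpψ hφ hpφ

omit [IsManifold (𝓡 m) ∞ M] in
theorem partialDeriv_embCoord_mdifferentiableAt (a : Fin n) (i : Fin m) :
    MDifferentiableAt (𝓡 n) 𝓘(ℝ, ℝ) (partialDeriv φ a (embCoord f ψ i)) p :=
  (partialDeriv_contMDiffAt hφ hpφ (embCoord_contMDiffAt hf hψ hpψ i) a).mdifferentiableAt (by simp)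

omit hφ hpφ in
theorem metricCoeff_comp_mdifferentiableAt (i j : Fin m) :
    MDifferentiableAt (𝓡 n) 𝓘(ℝ, ℝ) (fun r => metricCoeff η.inner ψ i j (f r)) p :=
  MDifferentiableAt.comp p (metricCoeff_mdifferentiableAt hψ η hpψ i j)
    (hf.mdifferentiableAt (by simp))

theorem metricCoeff_inducedMetric_mdifferentiableAt (a b : Fin n) :
    MDifferentiableAt (𝓡 n) 𝓘(ℝ, ℝ) (metricCoeff (inducedMetric η.inner f) φ a b) p := by
  refine MDifferentiableAt.congr_of_eventuallyEq ?_
    (metricCoeff_inducedMetric_eventuallyEq hf hψ hpψ a b)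
  exact mdifferentiableAt_sum fun i _ => mdifferentiableAt_sum fun j _ =>
    ((partialDeriv_embCoord_mdifferentiableAt hf hψ hpψ hφ hpφ a i).mul
      (partialDeriv_embCoord_mdifferentiableAt hf hψ hpψ hφ hpφ b j)).mul
        (metricCoeff_comp_mdifferentiableAt hf hψ hpψ i j)

/-- Product rule on `g_{bc} = η_{ij} ∂_b x^i ∂_c x^j`; the last sum is the chain rule for `η_{ij} ∘
f`. -/
theorem partialDeriv_metricCoeff_inducedMetric (a b c : Fin n) :
    partialDeriv φ a (metricCoeff (inducedMetric η.inner f) φ b c) p =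
      ∑ i, ∑ j, metricCoeff η.inner ψ i j (f p) *
        partialDeriv φ a (partialDeriv φ b (embCoord f ψ i)) p *
          partialDeriv φ c (embCoord f ψ j) p +
      ∑ i, ∑ j, metricCoeff η.inner ψ i j (f p) * partialDeriv φ b (embCoord f ψ i) p *
        partialDeriv φ a (partialDeriv φ c (embCoord f ψ j)) p +
      ∑ l, ∑ i, ∑ j, partialDeriv φ a (embCoord f ψ l) p * partialDeriv φ b (embCoord f ψ i) p *
        partialDeriv φ c (embCoord f ψ j) p *
          partialDeriv ψ l (metricCoeff η.inner ψ i j) (f p) := by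
  have hA := partialDeriv_embCoord_mdifferentiableAt hf hψ hpψ hφ hpφ
  have hh := metricCoeff_comp_mdifferentiableAt (η := η) hf hψ hpψ
  rw [partialDeriv_congr (metricCoeff_inducedMetric_eventuallyEq hf hψ hpψ b c),
    partialDeriv_sum (u := fun i r => ∑ j, partialDeriv φ b (embCoord f ψ i) r *
      partialDeriv φ c (embCoord f ψ j) r * metricCoeff η.inner ψ i j (f r)) fun i _ =>
        mdifferentiableAt_sum fun j _ => ((hA b i).mul (hA c j)).mul (hh i j)]
  have key : ∀ i, partialDeriv φ a (fun r => ∑ j, partialDeriv φ b (embCoord f ψ i) r *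
      partialDeriv φ c (embCoord f ψ j) r * metricCoeff η.inner ψ i j (f r)) p =
      ∑ j, metricCoeff η.inner ψ i j (f p) *
        partialDeriv φ a (partialDeriv φ b (embCoord f ψ i)) p *
          partialDeriv φ c (embCoord f ψ j) p +
      ∑ j, metricCoeff η.inner ψ i j (f p) * partialDeriv φ b (embCoord f ψ i) p *
        partialDeriv φ a (partialDeriv φ c (embCoord f ψ j)) p +
      ∑ l, ∑ j, partialDeriv φ a (embCoord f ψ l) p * partialDeriv φ b (embCoord f ψ i) p *
        partialDeriv φ c (embCoord f ψ j) p *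
          partialDeriv ψ l (metricCoeff η.inner ψ i j) (f p) := by
    intro i
    rw [partialDeriv_sum_mul
      (u := fun j r => partialDeriv φ b (embCoord f ψ i) r * partialDeriv φ c (embCoord f ψ j) r)
      (fun j _ => (hA b i).mul (hA c j)) (fun j _ => hh i j),
      Finset.sum_comm (f := fun l j => _ * partialDeriv ψ l _ (f p)), ← Finset.sum_add_distrib,
      ← Finset.sum_add_distrib]
    refine Finset.sum_congr rfl fun j _ => ?_
    rw [partialDeriv_comp_emb hf hψ hpψ (metricCoeff_mdifferentiableAt hψ η hpψ i j)]
    have := partialDeriv_mul (φ := φ) (hA b i) (hA c j) a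
    change partialDeriv φ a (fun r => partialDeriv φ b (embCoord f ψ i) r *
      partialDeriv φ c (embCoord f ψ j) r) p * _ + _ * _ = _
    rw [this, add_mul, Finset.mul_sum]
    congr 1
    · ring
    · exact Finset.sum_congr rfl fun l _ => by ring
  simp only [key, Finset.sum_add_distrib]
  congr 1
  exact Finset.sum_comm

/-- The Gauss formula for the coordinate vector fields. -/
theorem sum_metricCoeff_mul_christoffel_inducedMetric
    (hf_inj : ∀ p : S, Function.Injective (mfderiv (𝓡 n) (𝓡 m) f p)) (b a e : Fin n) :
    ∑ i, ∑ j, metricCoeff η.inner ψ i j (f p) * partialDeriv φ b (embCoord f ψ j) p *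
      (partialDeriv φ a (partialDeriv φ e (embCoord f ψ i)) p +
        ∑ l, ∑ r, partialDeriv φ a (embCoord f ψ l) p * christoffel η.inner ψ i l r (f p) *
          partialDeriv φ e (embCoord f ψ r) p) =
    ∑ c, metricCoeff (inducedMetric η.inner f) φ b c p *
      christoffel (inducedMetric η.inner f) φ c a e p := by
  have hcomm : ∀ i j q, metricCoeff η.inner ψ i j q = metricCoeff η.inner ψ j i q :=
    fun i j q => η.symm q _ _
  have hcomm' : ∀ i j, metricCoeff η.inner ψ i j = metricCoeff η.inner ψ j i :=
    fun i j => funext (hcomm i j)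
  have hB := fun a b i => partialDeriv_comm hφ hpφ (embCoord_contMDiffAt hf hψ hpψ i) a b
  rw [sum_metricCoeff_mul_christoffel hφ hpφ (inducedMetric_symm η.symm p)
    (inducedMetric_pos η.pos hf_inj p)]
  simp only [partialDeriv_metricCoeff_inducedMetric hf hψ hpψ hφ hpφ]
  set A : Fin n → Fin m → ℝ := fun a i => partialDeriv φ a (embCoord f ψ i) p with hAdef
  set B : Fin n → Fin n → Fin m → ℝ :=
    fun a b i => partialDeriv φ a (partialDeriv φ b (embCoord f ψ i)) p with hBdef
  set h : Fin m → Fin m → ℝ := fun i j => metricCoeff η.inner ψ i j (f p) with hhdef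
  set D : Fin m → Fin m → Fin m → ℝ :=
    fun l i j => partialDeriv ψ l (metricCoeff η.inner ψ i j) (f p) with hDdef
  have hhs : ∀ i j, h i j = h j i := fun i j => hcomm i j _
  have hDs : ∀ l i j, D l i j = D l j i := fun l i j => by simp only [hDdef, hcomm' i j]
  have hBs : ∀ a b i, B a b i = B b a i := hB
  -- Lowering the upper index leaves only derivatives of `η`, with no inverse metric.
  have hΓ : ∀ j l r, ∑ i, h j i * christoffel η.inner ψ i l r (f p) =
      (1 / 2 : ℝ) * (D l j r + D r j l - D j l r) := fun j l r =>
    sum_metricCoeff_mul_christoffel hψ hpψ (η.symm _) (η.pos _) j l r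
  have swap : ∀ x y : Fin m → ℝ, ∑ i, ∑ j, h i j * x i * y j = ∑ i, ∑ j, h i j * y i * x j := by
    intro x y
    rw [Finset.sum_comm]
    exact Finset.sum_congr rfl fun i _ => Finset.sum_congr rfl fun j _ => by
      rw [hhs j i]; ring
  have lhs : ∑ i, ∑ j, h i j * A b j *
      (B a e i + ∑ l, ∑ r, A a l * christoffel η.inner ψ i l r (f p) * A e r) =
      ∑ i, ∑ j, h i j * B a e i * A b j +
      (1 / 2 : ℝ) * (∑ l, ∑ i, ∑ j, A a l * A b i * A e j * D l i j +
        ∑ l, ∑ i, ∑ j, A e l * A b i * A a j * D l i j -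
        ∑ l, ∑ i, ∑ j, A b l * A a i * A e j * D l i j) := by
    have e1 : ∑ i, ∑ j, h i j * A b j *
        (∑ l, ∑ r, A a l * christoffel η.inner ψ i l r (f p) * A e r) =
        ∑ j, ∑ l, ∑ r, A b j * A a l * A e r *
          ((1 / 2 : ℝ) * (D l j r + D r j l - D j l r)) := by
      rw [Finset.sum_comm]
      refine Finset.sum_congr rfl fun j _ => ?_
      simp only [← hΓ, Finset.mul_sum]
      rw [Finset.sum_comm]
      refine Finset.sum_congr rfl fun l _ => ?_
      rw [Finset.sum_comm]
      exact Finset.sum_congr rfl fun r _ => Finset.sum_congr rfl fun i _ => by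
        rw [hhs i j]; ring
    have e2 : ∑ l, ∑ i, ∑ j, A a l * A b i * A e j * D l i j =
        ∑ j, ∑ l, ∑ r, A b j * A a l * A e r * D l j r := by
      rw [Finset.sum_comm]
      exact Finset.sum_congr rfl fun j _ => Finset.sum_congr rfl fun l _ =>
        Finset.sum_congr rfl fun r _ => by ring
    have e3 : ∑ l, ∑ i, ∑ j, A e l * A b i * A a j * D l i j =
        ∑ j, ∑ l, ∑ r, A b j * A a l * A e r * D r j l := by
      rw [Finset.sum_comm]
      refine Finset.sum_congr rfl fun j _ => ?_
      rw [Finset.sum_comm]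
      exact Finset.sum_congr rfl fun l _ => Finset.sum_congr rfl fun r _ => by ring
    rw [e2, e3]
    simp only [mul_add, Finset.sum_add_distrib]
    rw [e1]
    congr 1
    · exact Finset.sum_congr rfl fun i _ => Finset.sum_congr rfl fun j _ => by ring
    · simp only [mul_sub, Finset.mul_sum, ← Finset.sum_add_distrib, ← Finset.sum_sub_distrib]
      exact Finset.sum_congr rfl fun i _ => Finset.sum_congr rfl fun j _ =>
        Finset.sum_congr rfl fun r _ => by ring
  refine lhs.trans ?_
  change _ = (1 / 2 : ℝ) * (((∑ i, ∑ j, h i j * B a b i * A e j) +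
    (∑ i, ∑ j, h i j * A b i * B a e j) + ∑ l, ∑ i, ∑ j, A a l * A b i * A e j * D l i j) +
    ((∑ i, ∑ j, h i j * B e b i * A a j) +
    (∑ i, ∑ j, h i j * A b i * B e a j) + ∑ l, ∑ i, ∑ j, A e l * A b i * A a j * D l i j) -
    ((∑ i, ∑ j, h i j * B b a i * A e j) +
    (∑ i, ∑ j, h i j * A a i * B b e j) + ∑ l, ∑ i, ∑ j, A b l * A a i * A e j * D l i j))
  -- In the alternating sum of metric derivatives, `s1` and `s2` cancel the second derivatives with
  -- index `b`. By `s3` and `s4` the two remaining terms coincide, which absorbs the factor `1/2`.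
  have s1 : (∑ i, ∑ j, h i j * B b a i * A e j) = ∑ i, ∑ j, h i j * B a b i * A e j := by
    simp only [hBs b a]
  have s2 : (∑ i, ∑ j, h i j * A a i * B b e j) = ∑ i, ∑ j, h i j * B e b i * A a j := by
    rw [swap]; simp only [hBs b e]
  have s3 : (∑ i, ∑ j, h i j * A b i * B e a j) = ∑ i, ∑ j, h i j * B a e i * A b j := by
    rw [swap]; simp only [hBs e a]
  have s4 : (∑ i, ∑ j, h i j * A b i * B a e j) = ∑ i, ∑ j, h i j * B a e i * A b j := swap _ _
  rw [s1, s2, s3, s4]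
  ring

end Gauss

/-! ### Ambient derivatives, tangential projection and traces. -/

section AmbientDerivative

variable {m n : ℕ} {M : Type*} [TopologicalSpace M] [ChartedSpace (Model m) M]
  {S : Type*} [TopologicalSpace S] [ChartedSpace (Model n) S]

/-- The components `∂_a V^k + ∂_a x^l Γ̄^k_{lr} V^r` of the ambient covariant derivative of an
ambient vector field `V` along `S` in the direction of the coordinate vector `∂_a` of `S`. -/
noncomputable def ambientCovDeriv
    (η : ∀ q : M, TangentSpace (𝓡 m) q →L[ℝ] TangentSpace (𝓡 m) q →L[ℝ] ℝ)
    (f : S → M) (ψ : OpenPartialHomeomorph M (Model m)) (φ : OpenPartialHomeomorph S (Model n))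
    (V : Fin m → S → ℝ) (a : Fin n) (k : Fin m) (p : S) : ℝ :=
  partialDeriv φ a (V k) p + ∑ l, ∑ r, partialDeriv φ a (embCoord f ψ l) p *
    christoffel η ψ k l r (f p) * V r p

/-- The matrix `η_{ij} g^{ab} ∂_b x^j` of the orthogonal projection onto `S`. -/
noncomputable def tangentProjection
    (η : ∀ q : M, TangentSpace (𝓡 m) q →L[ℝ] TangentSpace (𝓡 m) q →L[ℝ] ℝ)
    (f : S → M) (ψ : OpenPartialHomeomorph M (Model m)) (φ : OpenPartialHomeomorph S (Model n))
    (i : Fin m) (a : Fin n) (p : S) : ℝ :=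
  ∑ j, ∑ b, metricCoeff η ψ i j (f p) * metricInvCoeff (inducedMetric η f) φ a b p *
    partialDeriv φ b (embCoord f ψ j) p

variable {f : S → M} {p : S}
  {ψ : OpenPartialHomeomorph M (Model m)} {φ : OpenPartialHomeomorph S (Model n)}

section HatNabla

variable {η : ∀ q : M, TangentSpace (𝓡 m) q →L[ℝ] TangentSpace (𝓡 m) q →L[ℝ] ℝ}
  {θ : PoissonBivector n S} {γ : S → ℝ}
  (hη : ∀ q v w, η q v w = η q w v) (hη' : ∀ q v, v ≠ 0 → 0 < η q v v)
  (hf : ContMDiff (𝓡 n) (𝓡 m) ∞ f)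
  (hf_inj : ∀ p : S, Function.Injective (mfderiv (𝓡 n) (𝓡 m) f p))
  (hθ : IsAlmostKahlerPoisson (inducedMetric η f) θ γ)
  (hψ : ψ ∈ IsManifold.maximalAtlas (𝓡 m) ∞ M) (hpψ : f p ∈ ψ.source)
include hη hη' hf hf_inj hθ hψ hpψ

theorem hatGrad_eq_ambientComponent (u : S → ℝ) (i : Fin m) :
    hatGrad η f θ γ ψ i u p =
      ambientComponent f ψ (metricGradient (d := n) (inducedMetric η f) u) i p := by
  have hpos := inducedMetric_pos hη' hf_inj p
  rw [hatGrad_eq_differential_raise hf hψ hpψ hθ hpos,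
    apply_raise_comm (inducedMetric_symm hη p) hpos]
  rfl

variable (hφ : φ ∈ IsManifold.maximalAtlas (𝓡 n) ∞ S) (hpφ : p ∈ φ.source)
include hφ hpφ

theorem hatGrad_eq_sum (i : Fin m) (w : S → ℝ) :
    hatGrad η f θ γ ψ i w p = ∑ a, ∑ b, metricInvCoeff (inducedMetric η f) φ a b p *
      partialDeriv φ a w p * partialDeriv φ b (embCoord f ψ i) p := by
  have hpos := inducedMetric_pos hη' hf_inj p
  rw [hatGrad_eq_differential_raise hf hψ hpψ hθ hpos,
    apply_raise_eq_sum hφ hpφ (inducedMetric_symm hη p) hpos]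
  rfl

/-- Both terms of `∇̂^j` differentiate through `𝓓^j`, which is `g^{ab} ∂_b x^j ∂_a`; pulling this
factor out leaves the ambient derivative along `∂_a`. -/
theorem hatNabla_eq_sum (j : Fin m) (V : Fin m → S → ℝ) (k : Fin m) :
    hatNabla η f θ γ ψ j V k p = ∑ a, ∑ b, metricInvCoeff (inducedMetric η f) φ a b p *
      partialDeriv φ b (embCoord f ψ j) p * ambientCovDeriv η f ψ φ V a k p := by
  simp only [hatNabla, ambientCovDeriv,
    hatGrad_eq_sum hη hη' hf hf_inj hθ hψ hpψ hφ hpφ, mul_add, Finset.sum_add_distrib]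
  congr 1
  · exact Finset.sum_congr rfl fun a _ => Finset.sum_congr rfl fun b _ => by ring
  · simp only [Finset.sum_mul, Finset.mul_sum]
    rw [Finset.sum_congr rfl fun l _ => Finset.sum_comm]
    rw [Finset.sum_comm]
    refine Finset.sum_congr rfl fun a _ => ?_
    rw [Finset.sum_congr rfl fun l _ => Finset.sum_comm]
    rw [Finset.sum_comm]
    exact Finset.sum_congr rfl fun b _ => Finset.sum_congr rfl fun l _ =>
      Finset.sum_congr rfl fun r _ => by ring

theorem hatNablaLower_eq_sum (i : Fin m) (V : Fin m → S → ℝ) (k : Fin m) :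
    hatNablaLower η f θ γ ψ i V k p =
      ∑ a, tangentProjection η f ψ φ i a p * ambientCovDeriv η f ψ φ V a k p := by
  simp only [hatNablaLower, tangentProjection,
    hatNabla_eq_sum hη hη' hf hf_inj hθ hψ hpψ hφ hpφ, Finset.sum_mul, Finset.mul_sum]
  rw [Finset.sum_comm]
  exact Finset.sum_congr rfl fun a _ => Finset.sum_congr rfl fun j _ =>
    Finset.sum_congr rfl fun b _ => by ring

end HatNabla

variable [IsManifold (𝓡 m) ∞ M]
  {η : Bundle.ContMDiffRiemannianMetric (𝓡 m) ∞ (Model m) (fun q : M => TangentSpace (𝓡 m) q)}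
  (hf : ContMDiff (𝓡 n) (𝓡 m) ∞ f)
  (hf_inj : ∀ p : S, Function.Injective (mfderiv (𝓡 n) (𝓡 m) f p))
  (hψ : ψ ∈ IsManifold.maximalAtlas (𝓡 m) ∞ M) (hpψ : f p ∈ ψ.source)
  (hφ : φ ∈ IsManifold.maximalAtlas (𝓡 n) ∞ S) (hpφ : p ∈ φ.source)
  {X : ∀ p : S, TangentSpace (𝓡 n) p}
  (hX : ∀ c, MDifferentiableAt (𝓡 n) 𝓘(ℝ, ℝ) (component φ X c) p)
  {V : Fin m → S → ℝ} (hV : ∀ k, V k =ᶠ[𝓝 p] ambientComponent f ψ X k)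
include hf hψ hpψ hφ hpφ hX hV

/-- Leibniz rule for `V^i = X^c ∂_c x^i`, separating derivatives of `X` from those of the coordinate
fields. Equality of germs in `hV` is what allows differentiation. -/
theorem ambientCovDeriv_eq_sum (a : Fin n) (i : Fin m) :
    ambientCovDeriv η.inner f ψ φ V a i p =
      ∑ c, partialDeriv φ a (component φ X c) p * partialDeriv φ c (embCoord f ψ i) p +
      ∑ e, component φ X e p * (partialDeriv φ a (partialDeriv φ e (embCoord f ψ i)) p +
        ∑ l, ∑ r, partialDeriv φ a (embCoord f ψ l) p * christoffel η.inner ψ i l r (f p) *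
          partialDeriv φ e (embCoord f ψ r) p) := by
  have h1 : V i =ᶠ[𝓝 p]
      fun r => ∑ c, component φ X c r * partialDeriv φ c (embCoord f ψ i) r := by
    filter_upwards [hV i, φ.open_source.mem_nhds hpφ] with r hr hr'
    rw [hr, ambientComponent_eq_sum hφ hr' X i]
  have h2 : ∀ r, V r p = ∑ c, component φ X c p * partialDeriv φ c (embCoord f ψ r) p :=
    fun r => by rw [(hV r).eq_of_nhds, ambientComponent_eq_sum hφ hpφ X r]
  simp only [ambientCovDeriv, h2]
  rw [partialDeriv_congr h1, partialDeriv_sum_mul (fun c _ => hX c)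
    (fun c _ => partialDeriv_embCoord_mdifferentiableAt hf hψ hpψ hφ hpφ c i)]
  simp only [Finset.sum_add_distrib, mul_add, add_assoc]
  congr 2
  simp only [Finset.mul_sum]
  rw [Finset.sum_congr rfl fun l _ => Finset.sum_comm, Finset.sum_comm]
  exact Finset.sum_congr rfl fun e _ => Finset.sum_congr rfl fun l _ =>
      Finset.sum_congr rfl fun r _ => by ring

include hf_inj

/-- The Gauss formula: the tangential part of the ambient covariant derivative of a tangent vector
field is its intrinsic covariant derivative. -/
theorem sum_metricCoeff_mul_ambientCovDeriv (b a : Fin n) :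
    ∑ i, ∑ j, metricCoeff η.inner ψ i j (f p) * partialDeriv φ b (embCoord f ψ j) p *
      ambientCovDeriv η.inner f ψ φ V a i p =
    ∑ c, metricCoeff (inducedMetric η.inner f) φ b c p *
      covDeriv (inducedMetric η.inner f) φ X a c p := by
  have hcomm : ∀ i j, metricCoeff η.inner ψ i j (f p) = metricCoeff η.inner ψ j i (f p) :=
    fun i j => η.symm _ _ _
  have e1 : ∑ c, metricCoeff (inducedMetric η.inner f) φ b c p *
      covDeriv (inducedMetric η.inner f) φ X a c p =
      ∑ c, metricCoeff (inducedMetric η.inner f) φ b c p *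
        partialDeriv φ a (component φ X c) p +
      ∑ e, component φ X e p * ∑ c, metricCoeff (inducedMetric η.inner f) φ b c p *
        christoffel (inducedMetric η.inner f) φ c a e p := by
    simp only [covDeriv, mul_add, Finset.sum_add_distrib, Finset.mul_sum]
    congr 1
    rw [Finset.sum_comm]
    exact Finset.sum_congr rfl fun e _ => Finset.sum_congr rfl fun c _ => by ring
  have e2 : ∀ c, metricCoeff (inducedMetric η.inner f) φ b c p = ∑ i, ∑ j,
      metricCoeff η.inner ψ i j (f p) * partialDeriv φ b (embCoord f ψ j) p *
        partialDeriv φ c (embCoord f ψ i) p := fun c => by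
    rw [(metricCoeff_inducedMetric_eventuallyEq hf hψ hpψ b c).eq_of_nhds, Finset.sum_comm]
    exact Finset.sum_congr rfl fun i _ => Finset.sum_congr rfl fun j _ => by
      rw [hcomm j i]; ring
  rw [e1]
  simp only [← sum_metricCoeff_mul_christoffel_inducedMetric hf hψ hpψ hφ hpφ hf_inj]
  simp only [e2]
  simp only [ambientCovDeriv_eq_sum hf hψ hpψ hφ hpφ hX hV]
  have key : ∀ (F : Fin m → Fin m → ℝ) (Z : Fin n → ℝ) (H : Fin n → Fin m → ℝ),
      ∑ i, ∑ j, F i j * ∑ c, Z c * H c i = ∑ c, Z c * ∑ i, ∑ j, F i j * H c i := by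
    intro F Z H
    simp only [Finset.mul_sum]
    rw [Finset.sum_congr rfl fun i _ => Finset.sum_comm, Finset.sum_comm]
    exact Finset.sum_congr rfl fun c _ => Finset.sum_congr rfl fun i _ =>
      Finset.sum_congr rfl fun j _ => by ring
  simp only [mul_add (_ * _) (∑ c, _) (∑ e, _), Finset.sum_add_distrib, key]
  congr 1
  exact Finset.sum_congr rfl fun c _ => mul_comm _ _

/-- The matrix identity `WP = ∇X`: apply `g^{ab}` to the Gauss formula to cancel `g_{bc}`. -/
theorem sum_ambientCovDeriv_mul_tangentProjection (c a : Fin n) :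
    ∑ i, ambientCovDeriv η.inner f ψ φ V c i p * tangentProjection η.inner f ψ φ i a p =
      covDeriv (inducedMetric η.inner f) φ X c a p := by
  have hs := inducedMetric_symm (f := f) (n := n) η.symm p
  have hpos := inducedMetric_pos η.pos hf_inj p
  calc _ = ∑ b, metricInvCoeff (inducedMetric η.inner f) φ a b p *
        ∑ i, ∑ j, metricCoeff η.inner ψ i j (f p) * partialDeriv φ b (embCoord f ψ j) p *
          ambientCovDeriv η.inner f ψ φ V c i p := by
        simp only [tangentProjection, Finset.mul_sum]
        rw [Finset.sum_congr rfl fun l _ => Finset.sum_comm, Finset.sum_comm]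
        exact Finset.sum_congr rfl fun e _ => Finset.sum_congr rfl fun l _ =>
          Finset.sum_congr rfl fun r _ => by ring
    _ = ∑ e, (∑ b, metricInvCoeff (inducedMetric η.inner f) φ a b p *
        metricCoeff (inducedMetric η.inner f) φ b e p) *
          covDeriv (inducedMetric η.inner f) φ X c e p := by
        simp only [sum_metricCoeff_mul_ambientCovDeriv hf hf_inj hψ hpψ hφ hpφ hX hV]
        simp only [Finset.mul_sum, Finset.sum_mul, mul_assoc]
        exact Finset.sum_comm
    _ = _ := by simp [sum_metricInvCoeff_mul hφ hpφ hs hpos]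

variable {θ : PoissonBivector n S} {γ : S → ℝ}
  (hθ : IsAlmostKahlerPoisson (inducedMetric η.inner f) θ γ)
include hθ

theorem metricDivergence_eq_sum_hatNablaLower :
    metricDivergence (inducedMetric η.inner f) φ X p =
      ∑ i, hatNablaLower η.inner f θ γ ψ i V i p := by
  simp only [hatNablaLower_eq_sum η.symm η.pos hf hf_inj hθ hψ hpψ hφ hpφ, metricDivergence,
    ← sum_ambientCovDeriv_mul_tangentProjection hf hf_inj hψ hpψ hφ hpφ hX hV]
  rw [Finset.sum_comm]
  exact Finset.sum_congr rfl fun i _ => Finset.sum_congr rfl fun a _ => mul_comm _ _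

theorem sum_covDeriv_mul_covDeriv_eq_sum_hatNablaLower :
    ∑ a, ∑ b, covDeriv (inducedMetric η.inner f) φ X a b p *
        covDeriv (inducedMetric η.inner f) φ X b a p =
      ∑ i, ∑ j, hatNablaLower η.inner f θ γ ψ i V j p *
        hatNablaLower η.inner f θ γ ψ j V i p := by
  let P : Matrix (Fin m) (Fin n) ℝ := Matrix.of fun i a => tangentProjection η.inner f ψ φ i a p
  let W : Matrix (Fin n) (Fin m) ℝ := Matrix.of fun a i => ambientCovDeriv η.inner f ψ φ V a i p
  have hWP : ∀ a b, covDeriv (inducedMetric η.inner f) φ X a b p = (W * P) a b := fun a b =>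
    (sum_ambientCovDeriv_mul_tangentProjection hf hf_inj hψ hpψ hφ hpφ hX hV a b).symm
  have hPW : ∀ i j, hatNablaLower η.inner f θ γ ψ i V j p = (P * W) i j := fun i j =>
    hatNablaLower_eq_sum η.symm η.pos hf hf_inj hθ hψ hpψ hφ hpφ i V j
  simp only [hWP, hPW]
  -- With `∇X = WP` and `∇̂V = PW`, both double sums are traces of squares, equal by cyclicity.
  change Matrix.trace ((W * P) * (W * P)) = Matrix.trace ((P * W) * (P * W))
  rw [Matrix.mul_assoc, Matrix.trace_mul_comm, Matrix.mul_assoc, Matrix.mul_assoc,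
    Matrix.mul_assoc]

end AmbientDerivative

end KahlerPoisson

/-! ### The four identities. -/

theorem mainTheorem12 {m n : ℕ}
    {M : Type*} [TopologicalSpace M] [ChartedSpace (Model m) M] [IsManifold (𝓡 m) ∞ M]
    {S : Type*} [TopologicalSpace S] [ChartedSpace (Model n) S] [IsManifold (𝓡 n) ∞ S]
    (η : Bundle.ContMDiffRiemannianMetric (𝓡 m) ∞ (Model m)
      (fun q : M => TangentSpace (𝓡 m) q))
    (f : S → M) (hf : ContMDiff (𝓡 n) (𝓡 m) ∞ f)
    (hf_inj : ∀ p : S, Function.Injective (mfderiv (𝓡 n) (𝓡 m) f p))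
    (θ : PoissonBivector n S) (γ : S → ℝ)
    (hθ : IsAlmostKahlerPoisson (inducedMetric η.inner f) θ γ)
    (u : S → ℝ) (hu : ContMDiff (𝓡 n) 𝓘(ℝ, ℝ) ∞ u)
    (X : ∀ p : S, TangentSpace (𝓡 n) p)
    (hX : ContMDiff (𝓡 n) (𝓡 n).tangent ∞ (fun p => (⟨p, X p⟩ : TangentBundle (𝓡 n) S)))
    (ψ : OpenPartialHomeomorph M (Model m)) (hψ : ψ ∈ IsManifold.maximalAtlas (𝓡 m) ∞ M)
    (φ : OpenPartialHomeomorph S (Model n)) (hφ : φ ∈ IsManifold.maximalAtlas (𝓡 n) ∞ S)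
    (p : S) (hpφ : p ∈ φ.source) (hpψ : f p ∈ ψ.source) :
    mfderiv (𝓡 n) (𝓡 m) f p (metricGradient (inducedMetric η.inner f) u p)
        = ∑ i, hatGrad η.inner f θ γ ψ i u p • coordVector ψ i (f p) ∧
    metricDivergence (inducedMetric η.inner f) φ X p
        = ∑ i, hatNablaLower η.inner f θ γ ψ i (ambientComponent f ψ X) i p ∧
    metricLaplacian (inducedMetric η.inner f) φ u p = ∑ i, hatHess η.inner f θ γ ψ u i i p ∧
    hessianNormSq (inducedMetric η.inner f) φ u p
        = ∑ i, ∑ j, hatHess η.inner f θ γ ψ u i j p * hatHess η.inner f θ γ ψ u j i p := by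
  have hs := inducedMetric_symm (f := f) (n := n) η.symm
  have hpos := inducedMetric_pos η.pos hf_inj
  have hG := metricCoeff_inducedMetric_mdifferentiableAt (η := η) hf hψ hpψ hφ hpφ
  have hY := component_metricGradient_mdifferentiableAt hφ hpφ hs hpos hG hu.contMDiffAt
  -- The components `∇̂^k(u)` agree with those of `grad u` only where `f` lands in the domain of
  -- `ψ`, hence as germs at `p`.
  have hV : ∀ k, (fun q => hatGrad η.inner f θ γ ψ k u q) =ᶠ[nhds p]
      ambientComponent f ψ (metricGradient (inducedMetric η.inner f) u) k := fun k => by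
    filter_upwards [emb_preimage_mem_nhds hf hpψ] with r hr
    exact hatGrad_eq_ambientComponent η.symm η.pos hf hf_inj hθ hψ hr u k
  refine ⟨?_, ?_, ?_, ?_⟩
  · rw [← sum_differential_smul_coordVector hψ hpψ (mfderiv (𝓡 n) (𝓡 m) f p _)]
    refine Finset.sum_congr rfl fun i _ => ?_
    rw [hatGrad_eq_ambientComponent η.symm η.pos hf hf_inj hθ hψ hpψ, ambientComponent,
      differential_embCoord hf hψ hpψ]
  · exact metricDivergence_eq_sum_hatNablaLower hf hf_inj hψ hpψ hφ hpφ
      (component_mdifferentiableAt hφ hpφ hX) (fun k => Filter.EventuallyEq.rfl) hθ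
  · exact metricDivergence_eq_sum_hatNablaLower hf hf_inj hψ hpψ hφ hpφ hY hV hθ
  · rw [hessianNormSq_eq hφ hpφ hs hpos hG hu.contMDiffAt]
    exact sum_covDeriv_mul_covDeriv_eq_sum_hatNablaLower hf hf_inj hψ hpψ hφ hpφ hY hV hθ
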